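/- Let $k$ be an algebraically closed field of characteristic $0$, let $N\ge 1$ and $\beta\ge 1$ be integers, and put $n=\binom{\beta+N-1}{N}$. For a field $K$ and a finite set $X$ of points of $\mathbb P^N_K$ with coordinates in $K$, let $R=K[x_0,\dots,x_N]$, $M=(x_0,\dots,x_N)$, and let $I_X=\bigcap_{p\in X}I(p)$, where $I(p)\subseteq R$ is the ideal generated by the forms vanishing at $p$. For an ideal $I\subseteq R$ let $I^{(m)}=\bigcap_{\mathfrak p}(I^mR_{\mathfrak p}\cap R)$ be its $m$-th symbolic power, where $\mathfrak p$ runs over the associated primes of $R/I$. Say that $X$ satisfies (HH) if $$I_X^{(Nm)}\subseteq M^{m(N-1)}I_X^m\qquad\text{for all } m\ge 1 .$$ (a) Condition (HH) holds for $n$ very general points of $\mathbb P^N_k$: in the Chow variety of $0$-cycles of degree $n$ in $\mathbb P^N_k$, that is, in $\mathrm{Sym}^n(\mathbb P^N_k)$, there are dense Zariski-open subsets $U_1,U_2,\dots$ with nonempty intersection $W=\bigcap_{i\ge 1}U_i$ such that every member of $W$ is a cycle $p_1+\dots+p_n$ of $n$ distinct points and the set $\{p_1,\dots,p_n\}$ satisfies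 (HH). (b) Condition (HH) holds for $n$ generic points: let $K=k(z_{ij}: 1\le i\le n,\ 0\le j\le N)$ be the field of rational functions in $n(N+1)$ variables, and let $P_i=[z_{i0}:z_{i1}:\dots:z_{iN}]\in\mathbb P^N_K$ for $1\le i\le n$. Then $\{P_1,\dots,P_n\}$ satisfies (HH). -/

import Mathlib

open scoped LinearAlgebra.Projectivization

noncomputable section

/-- The set of `K`-rational points of projective `N`-space over `K`. -/
abbrev PPoint (K : Type*) [Field K] (N : ℕ) : Type _ := ℙ K (Fin (N + 1) → K)

/-- The homogeneous coordinate ring `K[x_0, …, x_N]` of projective `N`-space. -/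
abbrev HCoordRing (K : Type*) [Field K] (N : ℕ) : Type _ := MvPolynomial (Fin (N + 1)) K

/-- The homogeneous maximal ideal `(x_0, …, x_N)`. -/
def irrelevantIdeal (K : Type*) [Field K] (N : ℕ) : Ideal (HCoordRing K N) :=
  Ideal.span (Set.range MvPolynomial.X)

/-- The defining ideal of a point of projective space: the ideal generated by the forms that vanish
at the point (vanishing of a form does not depend on the representative). -/
def pointIdeal {K : Type*} [Field K] {N : ℕ} (p : PPoint K N) : Ideal (HCoordRing K N) :=
  Ideal.span {f | (∃ d : ℕ, f.IsHomogeneous d) ∧ MvPolynomial.eval p.rep f = 0}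

/-- The defining (radical) ideal `I_X` of a set of points: the intersection of the ideals of its
points. -/
def definingIdeal {K : Type*} [Field K] {N : ℕ} (X : Set (PPoint K N)) : Ideal (HCoordRing K N) :=
  ⨅ p ∈ X, pointIdeal p

/-- The symbolic power `I^(m) = ⋂_p (I^m R_p ∩ R)`, where `p` runs over the associated primes of
`R ⧸ I`. -/
def symbolicPower {R : Type*} [CommRing R] (I : Ideal R) (m : ℕ) : Ideal R :=
  ⨅ p : associatedPrimes R (R ⧸ I),
    Ideal.comap (algebraMap R (Localization.AtPrime p.1))
      (Ideal.map (algebraMap R (Localization.AtPrime p.1)) (I ^ m))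

/-- The Harbourne–Huneke containments `I_X^(Nm) ⊆ M^(m(N-1)) I_X^m` for all `m ≥ 1`, for a set `X`
of points of projective `N`-space (meant for `N ≥ 1`). -/
def HarbourneHuneke {K : Type*} [Field K] {N : ℕ} (X : Set (PPoint K N)) : Prop :=
  ∀ m : ℕ, 1 ≤ m →
    symbolicPower (definingIdeal X) (N * m) ≤
      irrelevantIdeal K N ^ (m * (N - 1)) * definingIdeal X ^ m

/-- The Zariski topology on (the closed points of) the `n`-fold product of projective `N`-space:
the non-vanishing loci of multihomogeneous polynomials in the `n` groups of `N + 1` homogeneous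
coordinates form a basis. -/
abbrev zariskiProd (k : Type*) [Field k] (N n : ℕ) : TopologicalSpace (Fin n → PPoint k N) :=
  TopologicalSpace.generateFrom
    {U | ∃ (F : MvPolynomial (Fin n × Fin (N + 1)) k) (d : Fin n → ℕ),
      MvPolynomial.IsWeightedHomogeneous
        (fun ij : Fin n × Fin (N + 1) => (Pi.single ij.1 1 : Fin n → ℕ)) F d ∧
      U = {x | MvPolynomial.eval (fun ij : Fin n × Fin (N + 1) => (x ij.1).rep ij.2) F ≠ 0}}

/-- The effective `0`-cycle `p_1 + ⋯ + p_n` of an `n`-tuple of points. -/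
def cycleOf {k : Type*} [Field k] {N n : ℕ} (x : Fin n → PPoint k N) : Sym (PPoint k N) n :=
  Sym.mk (Multiset.map x Finset.univ.val) (by simp)

/-- The Zariski topology on (the closed points of) the Chow variety of `0`-cycles of degree `n` in
projective `N`-space, i.e. on the symmetric product, as the quotient of the `n`-fold product by the
symmetric group. -/
abbrev zariskiSym (k : Type*) [Field k] (N n : ℕ) : TopologicalSpace (Sym (PPoint k N) n) :=
  TopologicalSpace.coinduced cycleOf (zariskiProd k N n)

/-- A property `P` of sets of points holds for `n` very general points of projective `N`-space:
there is a nonempty set `W = ⋂ U i` of `0`-cycles, with each `U i` a dense Zariski-open subset of the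
Chow variety, such that every member of `W` is a sum of `n` distinct points whose set has `P`. -/
def HoldsForVeryGeneralPoints (k : Type*) [Field k] (N n : ℕ)
    (P : Set (PPoint k N) → Prop) : Prop :=
  ∃ U : ℕ → Set (Sym (PPoint k N) n),
    (∀ i, @IsOpen _ (zariskiSym k N n) (U i) ∧ @Dense _ (zariskiSym k N n) (U i)) ∧
    (⋂ i, U i).Nonempty ∧
    ∀ s ∈ ⋂ i, U i, (s : Multiset (PPoint k N)).Nodup ∧ P {p | p ∈ s}

/-- The field `k(z)` of rational functions in the `n (N + 1)` variables `z_ij`. -/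
abbrev GenericField (k : Type*) [Field k] (N n : ℕ) : Type _ :=
  FractionRing (MvPolynomial (Fin n × Fin (N + 1)) k)

/-- The coordinate vector `(z_i0, …, z_iN)` over `k(z)`. -/
def genericVec (k : Type*) [Field k] (N n : ℕ) (i : Fin n) : Fin (N + 1) → GenericField k N n :=
  fun j => algebraMap (MvPolynomial (Fin n × Fin (N + 1)) k) (GenericField k N n)
    (MvPolynomial.X (i, j))

theorem genericVec_ne_zero (k : Type*) [Field k] (N n : ℕ) (i : Fin n) :
    genericVec k N n i ≠ 0 := by
  intro h
  have h0 := congrFun h 0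
  simp [genericVec] at h0

/-- The `i`-th generic point `P_i = [z_i0 : ⋯ : z_iN]` of projective `N`-space over `k(z)`. -/
def genericProjPoint (k : Type*) [Field k] (N n : ℕ) (i : Fin n) : PPoint (GenericField k N n) N :=
  Projectivization.mk (GenericField k N n) (genericVec k N n i) (genericVec_ne_zero k N n i)

end

/-! Take `β + N - 1` hyperplanes in general position. Their `N`-fold intersections are `n` points, a
star configuration, and for it everything can be computed: the forms vanishing to order `q` at the
points lie in the ideal of the monomials `∏ ℓ_i ^ a_i` in which any `N` exponents add up to at least
`q` (`IsStar.mem_span_starMonomials`). Two consequences carry the proof. A nonzero form vanishing to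
order `N m` has degree at least `m (β + N - 1)` (`IsStar.eq_zero_of_vanishesTo`). In degrees at
least `m β`, vanishing to order `m` implies membership in `J ^ m`, where `J` is generated by the
forms of degree `β` through the points (`IsStar.mem_span_starProducts_pow`). Since `m (β + N - 1) =
m β + m (N - 1)`, a form that survives the first bound has at least `m (N - 1)` degrees to spare
beyond those of the generators of `J ^ m`, and these give the power of `M`.

For fixed `m` and degree `t`, each consequence says that a complex of two matrices, polynomial in
the coordinates of the points, is exact: one matrix lists generators, the other the vanishing
conditions. Exactness over a field is witnessed by an identity `P D + B Q = 1`, and it persists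
wherever the determinant of the left side is nonzero (`exists_exact_neighbourhood`). For `J ^ m` the
generators must move with the points. This is possible because the star points impose independent
conditions on forms of degree `β`, so each monomial can be corrected to vanish at nearby points
(`correctedForm`). The outcome, `IsStar.exists_formContainment`, is a polynomial `g` for each `(m,
t)`, nonzero at the star configuration, whose nonvanishing forces the containment in degree `t` over
every extension field.

A nonzero polynomial does not vanish at the generic coordinates, which gives (b). For (a) there are
countably many conditions, and each open set contains the cycle of the star configuration, so the
intersection is nonempty even when `k` is countable. -/

open MvPolynomial

noncomputable section

/-! ### Order of vanishing at a vector -/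

section Vanishing

variable {σ τ R S : Type*} [CommRing R] [CommRing S]

/-- The expansion `f(w + T y)` of a polynomial `f` around the vector `w`. -/
def taylorAt (w : σ → R) : MvPolynomial σ R →ₐ[R] Polynomial (MvPolynomial σ R) :=
  aeval fun j => Polynomial.C (C (w j)) + Polynomial.X * Polynomial.C (X j)

/-- The polynomial `f` vanishes at `w` to order at least `q`. -/
def VanishesTo (q : ℕ) (w : σ → R) (f : MvPolynomial σ R) : Prop :=
  (Polynomial.X : Polynomial (MvPolynomial σ R)) ^ q ∣ taylorAt w f

theorem taylorAt_X (w : σ → R) (j : σ) :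
    taylorAt w (X j) = Polynomial.C (C (w j)) + Polynomial.X * Polynomial.C (X j) := by
  simp [taylorAt]

theorem taylorAt_C (w : σ → R) (r : R) : taylorAt w (C r) = Polynomial.C (C r) := by
  simp only [taylorAt, aeval_C]
  rfl

theorem VanishesTo.mono {q r : ℕ} {w : σ → R} {f : MvPolynomial σ R} (h : VanishesTo q w f)
    (hr : r ≤ q) : VanishesTo r w f :=
  (pow_dvd_pow _ hr).trans h

theorem VanishesTo.mul {q r : ℕ} {w : σ → R} {f g : MvPolynomial σ R} (hf : VanishesTo q w f)
    (hg : VanishesTo r w g) : VanishesTo (q + r) w (f * g) := by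
  unfold VanishesTo at *
  rw [pow_add, map_mul]
  exact mul_dvd_mul hf hg

theorem VanishesTo.mul_left {q : ℕ} {w : σ → R} {f : MvPolynomial σ R} (hf : VanishesTo q w f)
    (g : MvPolynomial σ R) : VanishesTo q w (g * f) := by
  unfold VanishesTo at *
  rw [map_mul]
  exact hf.mul_left _

theorem VanishesTo.add {q : ℕ} {w : σ → R} {f g : MvPolynomial σ R} (hf : VanishesTo q w f)
    (hg : VanishesTo q w g) : VanishesTo q w (f + g) := by
  unfold VanishesTo at *
  rw [map_add]
  exact dvd_add hf hg

theorem VanishesTo.sub {q : ℕ} {w : σ → R} {f g : MvPolynomial σ R} (hf : VanishesTo q w f)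
    (hg : VanishesTo q w g) : VanishesTo q w (f - g) := by
  unfold VanishesTo at *
  rw [map_sub]
  exact dvd_sub hf hg

theorem vanishesTo_zero (q : ℕ) (w : σ → R) : VanishesTo q w (0 : MvPolynomial σ R) := by
  simp [VanishesTo]

theorem VanishesTo.pow {q : ℕ} {w : σ → R} {f : MvPolynomial σ R} (hf : VanishesTo q w f) (n : ℕ) :
    VanishesTo (q * n) w (f ^ n) := by
  unfold VanishesTo at *
  rw [map_pow, pow_mul]
  exact pow_dvd_pow_of_dvd hf n

theorem VanishesTo.prod {ι : Type*} (s : Finset ι) {q : ι → ℕ} {w : σ → R}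
    {f : ι → MvPolynomial σ R} (hf : ∀ i ∈ s, VanishesTo (q i) w (f i)) :
    VanishesTo (∑ i ∈ s, q i) w (∏ i ∈ s, f i) := by
  unfold VanishesTo at *
  rw [map_prod, ← Finset.prod_pow_eq_pow_sum]
  exact Finset.prod_dvd_prod_of_dvd _ _ hf

/-- The ideal of the polynomials vanishing to order at least `q`. -/
def vanishingIdeal (q : ℕ) (w : σ → R) : Ideal (MvPolynomial σ R) where
  carrier := {f | VanishesTo q w f}
  add_mem' := VanishesTo.add
  zero_mem' := vanishesTo_zero q w
  smul_mem' g _ hf := VanishesTo.mul_left hf g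

theorem taylorAt_coeff_zero (w : σ → R) (f : MvPolynomial σ R) :
    (taylorAt w f).coeff 0 = C (eval w f) := by
  induction f using MvPolynomial.induction_on with
  | C a => simp
  | add p q hp hq => simp [hp, hq]
  | mul_X p j hp => simp [hp, taylorAt_X, Polynomial.mul_coeff_zero]

theorem vanishesTo_one_iff {w : σ → R} {f : MvPolynomial σ R} :
    VanishesTo 1 w f ↔ eval w f = 0 := by
  rw [VanishesTo, pow_one, Polynomial.X_dvd_iff, taylorAt_coeff_zero, C_eq_zero]

theorem taylorAt_map (ρ : R →+* S) (w : σ → R) (f : MvPolynomial σ R) :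
    taylorAt (ρ ∘ w) (map ρ f) = (taylorAt w f).map (map ρ) := by
  induction f using MvPolynomial.induction_on with
  | C a => simp
  | add p q hp hq => simp [hp, hq]
  | mul_X p j hp => simp [hp, taylorAt_X]

theorem VanishesTo.map {q : ℕ} {w : σ → R} {f : MvPolynomial σ R} (hf : VanishesTo q w f)
    (ρ : R →+* S) : VanishesTo q (ρ ∘ w) (map ρ f) := by
  unfold VanishesTo at *
  rw [taylorAt_map]
  have := map_dvd (Polynomial.mapRingHom (MvPolynomial.map (σ := σ) ρ)) hf
  simpa using this

/-- The variable `T` is prime and does not divide the expansion of `u`, whose constant term is the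
value of `u` at `w`. -/
theorem VanishesTo.of_mul_left [IsDomain R] {q : ℕ} {w : σ → R} {u f : MvPolynomial σ R}
    (h : VanishesTo q w (u * f)) (hu : eval w u ≠ 0) : VanishesTo q w f := by
  unfold VanishesTo at h ⊢
  rw [map_mul] at h
  refine Polynomial.prime_X.pow_dvd_of_dvd_mul_left q ?_ h
  rwa [Polynomial.X_dvd_iff, taylorAt_coeff_zero, C_eq_zero]

variable [Fintype σ]

/-- The linear form with coefficient vector `ℓ`. -/
def linForm (ℓ : σ → R) : MvPolynomial σ R := ∑ j, C (ℓ j) * X j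

theorem linForm_isHomogeneous (ℓ : σ → R) : (linForm ℓ).IsHomogeneous 1 :=
  IsHomogeneous.sum _ _ _ fun j _ => isHomogeneous_C_mul_X _ j

theorem eval_linForm (ℓ w : σ → R) : eval w (linForm ℓ) = ℓ ⬝ᵥ w := by
  simp [linForm, dotProduct]

theorem aeval_linForm {A : Type*} [CommRing A] [Algebra R A] (ℓ : σ → R) (w : σ → A) :
    aeval w (linForm ℓ) = ∑ j, ℓ j • w j := by
  simp [linForm, Algebra.smul_def]

theorem taylorAt_linForm (ℓ w : σ → R) :
    taylorAt w (linForm ℓ) =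
      Polynomial.C (C (ℓ ⬝ᵥ w)) + Polynomial.X * Polynomial.C (linForm ℓ) := by
  rw [linForm, dotProduct, map_sum, map_sum, map_sum, map_sum, Finset.mul_sum,
    ← Finset.sum_add_distrib]
  refine Finset.sum_congr rfl fun j _ => ?_
  rw [map_mul, taylorAt_C, taylorAt_X, mul_add, Polynomial.C_mul, C_mul, Polynomial.C_mul]
  ring

theorem linForm_injective : Function.Injective (linForm : (σ → R) → MvPolynomial σ R) := by
  classical
  intro a b h
  funext i
  simpa [eval_linForm] using congrArg (eval (Pi.single i 1)) h

theorem linForm_eq_zero_iff {ℓ : σ → R} : linForm ℓ = 0 ↔ ℓ = 0 := by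
  have h0 : linForm (0 : σ → R) = 0 := by simp [linForm]
  exact ⟨fun h => linForm_injective (h.trans h0.symm), fun h => h ▸ h0⟩

/-- If the hyperplane passes through `w`, the expansion of its form is `T` times a nonzero constant
in `T`, so dividing it out costs exactly one order; otherwise it costs none. -/
theorem VanishesTo.of_linForm_mul [IsDomain R] {q : ℕ} {w : σ → R} {f : MvPolynomial σ R}
    {ℓ : σ → R} (hℓ : ℓ ≠ 0) (h : VanishesTo q w (linForm ℓ * f)) : VanishesTo (q - 1) w f := by
  by_cases hw : ℓ ⬝ᵥ w = 0
  · unfold VanishesTo at h ⊢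
    rw [map_mul, taylorAt_linForm, hw] at h
    rcases q with _ | q
    · simp
    · simp only [map_zero, zero_add, Nat.add_sub_cancel] at h ⊢
      rw [pow_succ', mul_assoc, mul_dvd_mul_iff_left Polynomial.X_ne_zero] at h
      refine Polynomial.prime_X.pow_dvd_of_dvd_mul_left q ?_ h
      rw [Polynomial.X_dvd_iff, Polynomial.coeff_C_zero, linForm_eq_zero_iff]
      exact hℓ
  · exact (h.of_mul_left (by rwa [eval_linForm])).mono (Nat.sub_le _ _)

/-- A linear substitution carrying `v` to `w` carries the line `v + T y` to a line through `w`, so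
it acts on the coefficients of the expansion and leaves `T` alone. -/
theorem VanishesTo.aeval_linForm {q : ℕ} {w : τ → R} {f : MvPolynomial τ R} {v : σ → R}
    (h : VanishesTo q w f) (M : τ → σ → R) (hM : ∀ j, M j ⬝ᵥ v = w j) :
    VanishesTo q v (aeval (fun j => linForm (M j)) f) := by
  have key : ∀ f : MvPolynomial τ R, taylorAt v (aeval (fun j => linForm (M j)) f) =
      (taylorAt w f).map (aeval (R := R) (fun j => linForm (M j))).toRingHom := by
    intro f
    induction f using MvPolynomial.induction_on with
    | C a =>
      rw [taylorAt_C, aeval_C, MvPolynomial.algebraMap_eq, taylorAt_C]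
      simp [MvPolynomial.algebraMap_eq]
    | add p q hp hq => rw [map_add, map_add, map_add, hp, hq, Polynomial.map_add]
    | mul_X p j hp =>
      rw [map_mul, map_mul, map_mul, Polynomial.map_mul, hp, aeval_X, taylorAt_X,
        taylorAt_linForm, hM]
      simp [MvPolynomial.algebraMap_eq]
  unfold VanishesTo at h ⊢
  rw [key]
  have := map_dvd (Polynomial.mapRingHom (aeval (R := R) (fun j => linForm (M j))).toRingHom) h
  simpa using this

theorem aeval_smul_X_of_isHomogeneous {σ : Type*} {f : MvPolynomial σ R} {t : ℕ}
    (hf : f.IsHomogeneous t) {A : Type*} [CommRing A] [Algebra R A] (c : A) (v : σ → A) :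
    aeval (fun j => c * v j) f = c ^ t * aeval v f := by
  rw [aeval_def, aeval_def, eval₂_eq, eval₂_eq, Finset.mul_sum]
  refine Finset.sum_congr rfl fun d hd => ?_
  have : d.degree = t := by
    by_contra h
    exact (mem_support_iff.mp hd) (hf.coeff_eq_zero h)
  simp only [mul_pow, Finset.prod_mul_distrib]
  rw [Finset.prod_pow_eq_pow_sum, ← this, Finsupp.degree_apply]
  ring

theorem VanishesTo.of_smul {K : Type*} [Field K] {q t : ℕ} {w : σ → K} {f : MvPolynomial σ K}
    {c : K} (hc : c ≠ 0) (hf : f.IsHomogeneous t) (h : VanishesTo q (c • w) f) :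
    VanishesTo q w f := by
  classical
  have h1 := h.aeval_linForm (v := w) (fun j => Pi.single j c) (fun j => by simp)
  have h2 : (fun j => linForm (Pi.single (M := fun _ => K) j c)) =
      fun j : σ => (C c * X j : MvPolynomial σ K) := by
    funext j
    simp [linForm, Pi.single_apply, apply_ite C, ite_mul]
  rw [h2, aeval_smul_X_of_isHomogeneous hf, aeval_X_left, AlgHom.id_apply, ← C_pow] at h1
  exact h1.of_mul_left (by simp [hc])

end Vanishing

/-! ### Homogeneous elements of an ideal generated by forms -/

section Homogeneous

variable {σ R : Type*} [CommRing R]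

/-- Only the degree `t` part of each coefficient of a generator contributes to a form of degree `t`.
The target `J` is merely an additive submonoid, so that it can be a graded piece, a linear span or
the image of one. -/
theorem mem_of_mem_span_of_isHomogeneous {s : Set (MvPolynomial σ R)}
    (hs : ∀ g ∈ s, ∃ d, g.IsHomogeneous d) {f : MvPolynomial σ R} {t : ℕ} (hft : f.IsHomogeneous t)
    (hf : f ∈ Ideal.span s) (J : AddSubmonoid (MvPolynomial σ R))
    (hJ : ∀ g ∈ s, ∀ d e h, g.IsHomogeneous d → h.IsHomogeneous e → e + d = t → h * g ∈ J) :
    f ∈ J := by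
  rw [← homogeneousComponent_eq_self hft]
  obtain ⟨n, r, g, rfl⟩ := Submodule.mem_span_set'.mp hf
  rw [map_sum]
  refine sum_mem fun i _ => ?_
  obtain ⟨d, hd⟩ := hs _ (g i).2
  rw [smul_eq_mul, ← sum_homogeneousComponent (r i), Finset.sum_mul, map_sum]
  refine sum_mem fun e _ => ?_
  have he := homogeneousComponent_isHomogeneous e (r i)
  rw [homogeneousComponent_of_mem (he.mul hd)]
  split_ifs with h
  · exact hJ _ (g i).2 d e _ hd he h.symm
  · exact J.zero_mem

end Homogeneous

/-! ### The ideal of a projective point -/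

section PointIdeal

variable {σ K : Type*} [Field K]

/-- The polynomial `f(U (w + T y))` in `U`, whose coefficients are the expansions around `w` of the
homogeneous components of `f`. -/
def coneTaylorAt (w : σ → K) :
    MvPolynomial σ K →ₐ[K] Polynomial (Polynomial (MvPolynomial σ K)) :=
  aeval fun j => Polynomial.X * Polynomial.C (taylorAt w (X j))

theorem coneTaylorAt_of_isHomogeneous (w : σ → K) {f : MvPolynomial σ K} {t : ℕ}
    (hf : f.IsHomogeneous t) :
    coneTaylorAt w f = Polynomial.X ^ t * Polynomial.C (taylorAt w f) := by
  rw [coneTaylorAt, aeval_smul_X_of_isHomogeneous hf Polynomial.X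
    (fun j => Polynomial.C (taylorAt w (X j)))]
  congr 1
  have : (Polynomial.CAlgHom (R := K)).comp (taylorAt w) = aeval (R := K) fun i =>
      (Polynomial.C (taylorAt w (X i)) : Polynomial (Polynomial (MvPolynomial σ K))) := by
    ext i : 1
    simp
  exact (DFunLike.congr_fun this f).symm

theorem coneTaylorAt_coeff (w : σ → K) (f : MvPolynomial σ K) (t : ℕ) :
    (coneTaylorAt w f).coeff t = taylorAt w (homogeneousComponent t f) := by
  conv_lhs => rw [← sum_homogeneousComponent f]
  rw [map_sum, Polynomial.finsetSum_coeff]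
  simp only [coneTaylorAt_of_isHomogeneous w (homogeneousComponent_isHomogeneous _ f),
    Polynomial.coeff_X_pow_mul', Polynomial.coeff_C]
  by_cases h : t ≤ f.totalDegree
  · rw [Finset.sum_eq_single t]
    · simp
    · intro b _ hb
      split_ifs <;> first | omega | rfl
    · intro hb
      simp at hb
      omega
  · rw [homogeneousComponent_eq_zero _ _ (by omega), map_zero]
    refine Finset.sum_eq_zero fun b hb => ?_
    simp at hb
    split_ifs <;> first | omega | rfl

/-- The extra variable `U` separates the degrees. A condition on all homogeneous components thereby
becomes divisibility by a power of one prime element, which makes primality and cancellation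
immediate. -/
theorem C_X_pow_dvd_coneTaylorAt_iff {w : σ → K} {f : MvPolynomial σ K} {q : ℕ} :
    Polynomial.C Polynomial.X ^ q ∣ coneTaylorAt w f ↔
      ∀ t, VanishesTo q w (homogeneousComponent t f) := by
  rw [← Polynomial.C_pow, Polynomial.C_dvd_iff_dvd_coeff]
  simp only [coneTaylorAt_coeff, VanishesTo]

end PointIdeal

/-! ### Symbolic powers of ideals of points -/

section SymbolicPower

variable {K : Type*} [Field K] {N : ℕ}

/-- The ideal of the polynomials all of whose homogeneous components vanish at `w` to order at least
`q`. -/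
def coneIdeal (q : ℕ) (w : Fin (N + 1) → K) : Ideal (HCoordRing K N) where
  carrier := {f | Polynomial.C Polynomial.X ^ q ∣ coneTaylorAt w f}
  add_mem' hf hg := by
    rw [Set.mem_ofPred_eq, map_add]
    exact dvd_add hf hg
  zero_mem' := by simp
  smul_mem' g f hf := by
    rw [smul_eq_mul, Set.mem_ofPred_eq, map_mul]
    exact dvd_mul_of_dvd_right (α := Polynomial (Polynomial (MvPolynomial (Fin (N + 1)) K))) hf _

theorem mem_coneIdeal {q : ℕ} {w : Fin (N + 1) → K} {f : HCoordRing K N} :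
    f ∈ coneIdeal q w ↔ Polynomial.C Polynomial.X ^ q ∣ coneTaylorAt w f :=
  Iff.rfl

theorem mem_coneIdeal_iff {q : ℕ} {w : Fin (N + 1) → K} {f : HCoordRing K N} :
    f ∈ coneIdeal q w ↔ ∀ t, VanishesTo q w (homogeneousComponent t f) :=
  C_X_pow_dvd_coneTaylorAt_iff

theorem pointIdeal_eq_coneIdeal (p : PPoint K N) : pointIdeal p = coneIdeal 1 p.rep := by
  refine le_antisymm (Ideal.span_le.mpr ?_) ?_
  · rintro g ⟨⟨d, hd⟩, hg⟩
    rw [SetLike.mem_coe, mem_coneIdeal_iff]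
    intro t
    rw [homogeneousComponent_of_mem hd]
    split_ifs
    · exact vanishesTo_one_iff.mpr hg
    · exact vanishesTo_zero _ _
  · intro f hf
    rw [mem_coneIdeal_iff] at hf
    rw [← sum_homogeneousComponent f]
    exact sum_mem fun t _ => Ideal.subset_span
      ⟨⟨t, homogeneousComponent_isHomogeneous t f⟩, vanishesTo_one_iff.mp (hf t)⟩

theorem prime_C_X {A : Type*} [CommRing A] [IsDomain A] :
    Prime (Polynomial.C Polynomial.X : Polynomial (Polynomial A)) :=
  Polynomial.prime_C_iff.mpr Polynomial.prime_X

theorem pointIdeal_isPrime (p : PPoint K N) : (pointIdeal p).IsPrime := by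
  rw [pointIdeal_eq_coneIdeal]
  refine ⟨fun h => ?_, fun {f g} h => ?_⟩
  · have h1 := (Ideal.eq_top_iff_one _).mp h
    rw [mem_coneIdeal, map_one, pow_one] at h1
    exact prime_C_X.not_isUnit (isUnit_of_dvd_one h1)
  · simp only [mem_coneIdeal, map_mul, pow_one] at h ⊢
    exact prime_C_X.dvd_or_dvd h

theorem pointIdeal_pow_le (p : PPoint K N) (q : ℕ) : pointIdeal p ^ q ≤ coneIdeal q p.rep := by
  induction q with
  | zero => exact fun f _ => by simp [mem_coneIdeal]
  | succ q ih =>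
    rw [pow_succ, Ideal.mul_le]
    intro f hf g hg
    rw [pointIdeal_eq_coneIdeal, mem_coneIdeal, pow_one] at hg
    rw [mem_coneIdeal, map_mul, pow_succ]
    exact mul_dvd_mul (α := Polynomial (Polynomial (MvPolynomial (Fin (N + 1)) K))) (ih hf) hg

/-- The `2 × 2` minors against the coordinates of `p'` vanish at `p'`, hence at `p`, so the two
vectors are proportional. -/
theorem eq_of_pointIdeal_le {p p' : PPoint K N} (h : pointIdeal p' ≤ pointIdeal p) : p' = p := by
  obtain ⟨i, hi⟩ : ∃ i, p'.rep i ≠ 0 := by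
    by_contra! h0
    exact p'.rep_nonzero (funext h0)
  have key : ∀ j, p.rep j * p'.rep i = p.rep i * p'.rep j := by
    intro j
    have hmem : (X j * C (p'.rep i) - X i * C (p'.rep j) : HCoordRing K N) ∈ pointIdeal p' := by
      refine Ideal.subset_span ⟨⟨1, ?_⟩, ?_⟩
      · exact ((isHomogeneous_X K j).mul (isHomogeneous_C _ _)).sub
          ((isHomogeneous_X K i).mul (isHomogeneous_C _ _))
      · simp [mul_comm]
    have h2 := h hmem
    rw [pointIdeal_eq_coneIdeal, mem_coneIdeal_iff] at h2
    replace h2 := h2 1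
    rw [homogeneousComponent_eq_self, vanishesTo_one_iff] at h2
    · simpa [sub_eq_zero] using h2
    · exact ((isHomogeneous_X K j).mul (isHomogeneous_C _ _)).sub
          ((isHomogeneous_X K i).mul (isHomogeneous_C _ _))
  have hpi : p.rep i ≠ 0 := by
    intro h0
    refine p.rep_nonzero (funext fun j => ?_)
    simpa [h0, hi] using key j
  rw [← p'.mk_rep, ← p.mk_rep, Projectivization.mk_eq_mk_iff' K _ _ p'.rep_nonzero p.rep_nonzero]
  refine ⟨p'.rep i / p.rep i, funext fun j => ?_⟩
  rw [Pi.smul_apply, smul_eq_mul, div_mul_eq_mul_div, div_eq_iff hpi]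
  linear_combination key j

/-- Point ideals are prime and pairwise incomparable, so some `g` lies in the ideals of all the
other points but not in that of `p`. The annihilator of its class is the ideal of `p`. -/
theorem pointIdeal_mem_associatedPrimes {X : Set (PPoint K N)} (hX : X.Finite) {p : PPoint K N}
    (hp : p ∈ X) :
    pointIdeal p ∈ associatedPrimes (HCoordRing K N) (HCoordRing K N ⧸ definingIdeal X) := by
  classical
  obtain ⟨g, hg, hgp⟩ : ∃ g ∈ (hX.toFinset.erase p).inf pointIdeal, g ∉ pointIdeal p := by
    by_contra! h
    obtain ⟨p', hp', hle⟩ := (pointIdeal_isPrime p).inf_le'.mp h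
    exact (Finset.mem_erase.mp hp').1 (eq_of_pointIdeal_le hle)
  refine isAssociatedPrime_iff.mpr ⟨pointIdeal_isPrime p, Ideal.Quotient.mk _ g, ?_⟩
  ext r
  rw [Submodule.mem_colon_singleton, Submodule.mem_bot,
    ← Ideal.Quotient.mkₐ_eq_mk (HCoordRing K N), ← map_smul, Ideal.Quotient.mkₐ_eq_mk,
    Ideal.Quotient.eq_zero_iff_mem, definingIdeal]
  simp only [Ideal.mem_iInf]
  constructor
  · intro hr p' hp'
    by_cases h : p' = p
    · exact h ▸ Ideal.mul_mem_right _ _ hr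
    · refine Ideal.mul_mem_left _ _ ?_
      have : (hX.toFinset.erase p).inf pointIdeal ≤ pointIdeal p' :=
        Finset.inf_le (Finset.mem_erase.mpr ⟨h, hX.mem_toFinset.mpr hp'⟩)
      exact this hg
  · intro h
    exact ((pointIdeal_isPrime p).mem_or_mem (h p hp)).resolve_right hgp

/-- Localizing at the ideal of `p` gives `u * f ∈ I ^ q` with `u` outside that prime; the factor `u`
then cancels, because the divisibility that describes order of vanishing is by a prime. Only this
direction is needed, since symbolic powers occur on the left of the containment. -/
theorem vanishesTo_of_mem_symbolicPower {X : Set (PPoint K N)} (hX : X.Finite) {q : ℕ}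
    {f : HCoordRing K N} (hf : f ∈ symbolicPower (definingIdeal X) q) {p : PPoint K N}
    (hp : p ∈ X) (t : ℕ) : VanishesTo q p.rep (homogeneousComponent t f) := by
  have := pointIdeal_isPrime p
  have h1 : f ∈ Ideal.comap (algebraMap (HCoordRing K N) (Localization.AtPrime (pointIdeal p)))
      (Ideal.map (algebraMap (HCoordRing K N) (Localization.AtPrime (pointIdeal p)))
        (definingIdeal X ^ q)) :=
    (Ideal.mem_iInf.mp hf) ⟨_, pointIdeal_mem_associatedPrimes hX hp⟩
  rw [Ideal.mem_comap, IsLocalization.algebraMap_mem_map_algebraMap_iff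
    (pointIdeal p).primeCompl] at h1
  obtain ⟨u, hu, huf⟩ := h1
  have h2 := pointIdeal_pow_le p q
    (Ideal.pow_right_mono (iInf₂_le p hp : definingIdeal X ≤ pointIdeal p) q huf)
  rw [mem_coneIdeal, map_mul] at h2
  refine mem_coneIdeal_iff.mp (prime_C_X.pow_dvd_of_dvd_mul_left q (fun h => hu ?_) h2) t
  rwa [SetLike.mem_coe, pointIdeal_eq_coneIdeal, mem_coneIdeal, pow_one]

/-- The part of the containment `I_X^(Nm) ⊆ M^(m(N-1)) I_X^m` concerning forms of degree `t`. -/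
def FormContainment (m t : ℕ) (X : Set (PPoint K N)) : Prop :=
  ∀ f : HCoordRing K N, f.IsHomogeneous t → (∀ p ∈ X, VanishesTo (N * m) p.rep f) →
    f ∈ irrelevantIdeal K N ^ (m * (N - 1)) * definingIdeal X ^ m

/-- Splitting by degree turns the condition into countably many statements about finite-dimensional
spaces of forms. -/
theorem harbourneHuneke_of_formContainment {X : Set (PPoint K N)} (hX : X.Finite)
    (h : ∀ m t, 1 ≤ m → FormContainment m t X) : HarbourneHuneke X := by
  intro m hm f hf
  rw [← sum_homogeneousComponent f]
  exact sum_mem fun t _ => h m t hm _ (homogeneousComponent_isHomogeneous t f)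
    fun p hp => vanishesTo_of_mem_symbolicPower hX hf hp t

theorem VanishesTo.rep_mk {q t : ℕ} {w : Fin (N + 1) → K} (hw : w ≠ 0) {f : HCoordRing K N}
    (hf : f.IsHomogeneous t) (h : VanishesTo q (Projectivization.mk K w hw).rep f) :
    VanishesTo q w f := by
  obtain ⟨a, ha⟩ := Projectivization.exists_smul_eq_mk_rep K w hw
  rw [← ha] at h
  exact VanishesTo.of_smul a.ne_zero hf h

theorem mem_pointIdeal_mk {t : ℕ} {w : Fin (N + 1) → K} (hw : w ≠ 0) {f : HCoordRing K N}
    (hf : f.IsHomogeneous t) (h : eval w f = 0) : f ∈ pointIdeal (Projectivization.mk K w hw) := by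
  obtain ⟨a, ha⟩ := Projectivization.exists_smul_eq_mk_rep K w hw
  refine Ideal.subset_span ⟨⟨t, hf⟩, ?_⟩
  have hw' : w = ((a⁻¹ : Kˣ) : K) • (Projectivization.mk K w hw).rep := by
    rw [← ha]
    simp [Units.smul_def, smul_smul]
  rw [← vanishesTo_one_iff] at h ⊢
  rw [hw'] at h
  exact VanishesTo.of_smul (Units.ne_zero _) hf h

end SymbolicPower

/-! ### Star configurations -/

section Star

variable {K ι : Type*} [Field K]

/-- Linear forms `ℓ i`, `i ∈ s`, on an `(N + 1)`-dimensional space, in general position: each set `A`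
of at most `N` of the hyperplanes has a point `P A` lying on no other of the hyperplanes. -/
structure IsStar {N : ℕ} (s : Finset ι) (ℓ : ι → Fin (N + 1) → K)
    (P : Finset ι → Fin (N + 1) → K) : Prop where
  ne_zero : ∀ A ⊆ s, A.card ≤ N → P A ≠ 0
  dotProduct_eq_zero_iff : ∀ A ⊆ s, A.card ≤ N → ∀ i ∈ s, ℓ i ⬝ᵥ P A = 0 ↔ i ∈ A

theorem IsStar.form_ne_zero {N : ℕ} {s : Finset ι} {ℓ : ι → Fin (N + 1) → K}
    {P : Finset ι → Fin (N + 1) → K} (h : IsStar s ℓ P) {i : ι} (hi : i ∈ s) : ℓ i ≠ 0 := by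
  intro h0
  have := (h.dotProduct_eq_zero_iff ∅ (by simp) (by simp) i hi).mp (by simp [h0])
  simp at this

/-- The monomials in the linear forms which vanish to order `q` at the points of the star
configuration, when the form `ℓ i` is counted `w i` more times than it occurs. -/
def starMonomials {N : ℕ} (s : Finset ι) (ℓ : ι → Fin (N + 1) → K) (w : ι → ℕ) (q : ℕ) :
    Set (HCoordRing K N) :=
  {g | ∃ a : ι → ℕ, (∀ A ⊆ s, A.card = N → q ≤ ∑ i ∈ A, (a i + w i)) ∧
    g = ∏ i ∈ s, linForm (ℓ i) ^ a i}

theorem isHomogeneous_prod_linForm_pow {N : ℕ} (s : Finset ι) (ℓ : ι → Fin (N + 1) → K)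
    (a : ι → ℕ) : (∏ i ∈ s, linForm (ℓ i) ^ a i).IsHomogeneous (∑ i ∈ s, a i) :=
  IsHomogeneous.prod _ _ _ fun i _ => by simpa using (linForm_isHomogeneous (ℓ i)).pow (a i)

variable [DecidableEq ι]

theorem starMonomials_vanishesTo {N : ℕ} {s : Finset ι} {ℓ : ι → Fin (N + 1) → K}
    {P : Finset ι → Fin (N + 1) → K} (h : IsStar s ℓ P) {w : ι → ℕ} {q : ℕ} {g : HCoordRing K N}
    (hg : g ∈ Ideal.span (starMonomials s ℓ w q)) {A : Finset ι} (hA : A ⊆ s) (hAN : A.card = N) :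
    VanishesTo (q - ∑ i ∈ A, w i) (P A) g := by
  have hle : Ideal.span (starMonomials s ℓ w q) ≤ vanishingIdeal (q - ∑ i ∈ A, w i) (P A) := by
    refine Ideal.span_le.mpr ?_
    rintro _ ⟨a, ha, rfl⟩
    have h1 : VanishesTo (∑ i ∈ s, if i ∈ A then a i else 0) (P A)
        (∏ i ∈ s, linForm (ℓ i) ^ a i) := by
      refine VanishesTo.prod s fun i hi => ?_
      split_ifs with hiA
      · have : VanishesTo 1 (P A) (linForm (ℓ i)) := by
          rw [vanishesTo_one_iff, eval_linForm]
          exact (h.dotProduct_eq_zero_iff A hA hAN.le i hi).mpr hiA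
        simpa using this.pow (a i)
      · simp [VanishesTo]
    refine VanishesTo.mono h1 ?_
    rw [← Finset.sum_filter, Finset.filter_mem_eq_inter, Finset.inter_eq_right.mpr hA]
    have := ha A hA hAN
    rw [Finset.sum_add_distrib] at this
    omega
  exact hle hg

/-! ### Restriction of forms and star configurations to a hyperplane -/

section Restriction

variable {N : ℕ}

/-- The restriction of a linear form to the hyperplane of `m`, in the coordinates other than `p`. -/
def restrictForm (m : Fin (N + 2) → K) (p : Fin (N + 2)) (ℓ : Fin (N + 2) → K) :
    Fin (N + 1) → K :=
  fun j => ℓ (p.succAbove j) - ℓ p / m p * m (p.succAbove j)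

/-- The coordinates of a point of the hyperplane of `m` in terms of those other than `p`. -/
def hyperplaneCoord (m : Fin (N + 2) → K) (p : Fin (N + 2)) : Fin (N + 2) → Fin (N + 1) → K :=
  p.insertNth (fun j => -((m p)⁻¹ * m (p.succAbove j))) (fun j => Pi.single j 1)

/-- The restriction of forms to the hyperplane of `m`. -/
def restrictTo (m : Fin (N + 2) → K) (p : Fin (N + 2)) :
    HCoordRing K (N + 1) →ₐ[K] HCoordRing K N :=
  aeval fun j => linForm (hyperplaneCoord m p j)

theorem linForm_single (j : Fin (N + 1)) : linForm (Pi.single j (1 : K)) = X j := by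
  simp [linForm, Pi.single_apply, apply_ite C, ite_mul]

theorem restrictTo_rename (m : Fin (N + 2) → K) (p : Fin (N + 2)) (f : HCoordRing K N) :
    restrictTo m p (rename p.succAbove f) = f := by
  rw [restrictTo, aeval_rename]
  have : (fun j => linForm (hyperplaneCoord m p j)) ∘ p.succAbove = X := by
    funext j
    simp [hyperplaneCoord, linForm_single]
  rw [this, aeval_X_left, AlgHom.id_apply]

theorem restrictTo_linForm (m : Fin (N + 2) → K) (p : Fin (N + 2)) (ℓ : Fin (N + 2) → K) :
    restrictTo m p (linForm ℓ) = linForm (restrictForm m p ℓ) := by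
  rw [restrictTo, aeval_linForm, Fin.sum_univ_succAbove _ p]
  simp only [hyperplaneCoord, Fin.insertNth_apply_same, Fin.insertNth_apply_succAbove,
    linForm_single]
  simp only [linForm, restrictForm, Finset.smul_sum, smul_eq_C_mul]
  rw [← Finset.sum_add_distrib]
  refine Finset.sum_congr rfl fun j _ => ?_
  rw [← mul_assoc, ← C_mul, ← add_mul, ← C_add]
  congr 2
  ring

/-- Modulo the form of `m`, the coordinate `p` is a combination of the others, so restricting and
then extending back is the identity on the quotient. -/
theorem sub_rename_restrictTo_mem {m : Fin (N + 2) → K} {p : Fin (N + 2)} (hp : m p ≠ 0)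
    (f : HCoordRing K (N + 1)) :
    f - rename p.succAbove (restrictTo m p f) ∈ Ideal.span {linForm m} := by
  have key : (Ideal.Quotient.mkₐ K (Ideal.span {linForm m})) =
      ((Ideal.Quotient.mkₐ K (Ideal.span {linForm m})).comp (rename p.succAbove)).comp
        (restrictTo m p) := by
    refine MvPolynomial.algHom_ext fun j => ?_
    rw [AlgHom.comp_apply, AlgHom.comp_apply, ← sub_eq_zero, ← map_sub,
      Ideal.Quotient.mkₐ_eq_mk, Ideal.Quotient.eq_zero_iff_mem]
    revert j
    rw [Fin.forall_iff_succAbove p]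
    constructor
    · have : X p - rename p.succAbove (restrictTo m p (X p)) = C (m p)⁻¹ * linForm m := by
        simp only [restrictTo, aeval_X, hyperplaneCoord, Fin.insertNth_apply_same, linForm, map_sum,
          map_mul, rename_C, rename_X]
        rw [Fin.sum_univ_succAbove _ p, mul_add, ← mul_assoc, ← C_mul, inv_mul_cancel₀ hp, C_1,
          one_mul, Finset.mul_sum, sub_eq_add_neg, ← Finset.sum_neg_distrib]
        congr 1
        refine Finset.sum_congr rfl fun j _ => ?_
        rw [C_neg, C_mul]
        ring
      rw [this]
      exact Ideal.mul_mem_left _ _ (Ideal.subset_span rfl)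
    · intro j
      simp [restrictTo, hyperplaneCoord, linForm_single]
  have := DFunLike.congr_fun key f
  rwa [AlgHom.comp_apply, AlgHom.comp_apply, ← sub_eq_zero, ← map_sub, Ideal.Quotient.mkₐ_eq_mk,
    Ideal.Quotient.eq_zero_iff_mem] at this

theorem restrictForm_dotProduct {m v : Fin (N + 2) → K} {p : Fin (N + 2)} (hp : m p ≠ 0)
    (hv : m ⬝ᵥ v = 0) (ℓ : Fin (N + 2) → K) :
    restrictForm m p ℓ ⬝ᵥ (fun j => v (p.succAbove j)) = ℓ ⬝ᵥ v := by
  rw [dotProduct, Fin.sum_univ_succAbove _ p] at hv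
  rw [dotProduct, dotProduct, Fin.sum_univ_succAbove _ p]
  simp only [restrictForm, sub_mul, Finset.sum_sub_distrib, mul_assoc, ← Finset.mul_sum]
  have : ∑ j, m (p.succAbove j) * v (p.succAbove j) = -(m p * v p) := by
    linear_combination hv
  rw [this]
  field_simp
  ring

theorem hyperplaneCoord_dotProduct {m v : Fin (N + 2) → K} {p : Fin (N + 2)} (hp : m p ≠ 0)
    (hv : m ⬝ᵥ v = 0) (j : Fin (N + 2)) :
    hyperplaneCoord m p j ⬝ᵥ (fun j => v (p.succAbove j)) = v j := by
  revert j
  rw [Fin.forall_iff_succAbove p]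
  constructor
  · rw [dotProduct, Fin.sum_univ_succAbove _ p] at hv
    simp only [hyperplaneCoord, Fin.insertNth_apply_same, dotProduct, neg_mul, mul_assoc,
      Finset.sum_neg_distrib, ← Finset.mul_sum]
    have : ∑ j, m (p.succAbove j) * v (p.succAbove j) = -(m p * v p) := by
      linear_combination hv
    rw [this]
    field_simp
  · intro j
    simp [hyperplaneCoord]

/-- The points on the hyperplane of `i` are those indexed by sets containing `i`; dropping `i` from
these sets gives a star configuration of one dimension less. -/
theorem IsStar.restrict {s : Finset ι} {ℓ : ι → Fin (N + 2) → K}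
    {P : Finset ι → Fin (N + 2) → K} (h : IsStar s ℓ P) {i : ι} (hi : i ∈ s) {p : Fin (N + 2)}
    (hp : ℓ i p ≠ 0) :
    IsStar (s.erase i) (fun d => restrictForm (ℓ i) p (ℓ d))
      (fun A j => P (insert i A) (p.succAbove j)) := by
  have hins : ∀ A ⊆ s.erase i, A.card ≤ N → insert i A ⊆ s ∧ (insert i A).card ≤ N + 1 := by
    intro A hA hc
    refine ⟨Finset.insert_subset hi (hA.trans (Finset.erase_subset _ _)), ?_⟩
    exact (Finset.card_insert_le _ _).trans (by omega)
  have hzero : ∀ A ⊆ s.erase i, A.card ≤ N → ℓ i ⬝ᵥ P (insert i A) = 0 := fun A hA hc =>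
    (h.dotProduct_eq_zero_iff _ (hins A hA hc).1 (hins A hA hc).2 i hi).mpr
      (Finset.mem_insert_self _ _)
  constructor
  · intro A hA hc h0
    refine h.ne_zero _ (hins A hA hc).1 (hins A hA hc).2 (funext fun j => ?_)
    rw [← hyperplaneCoord_dotProduct hp (hzero A hA hc), h0, dotProduct_zero]
    rfl
  · intro A hA hc d hd
    rw [restrictForm_dotProduct hp (hzero A hA hc),
      h.dotProduct_eq_zero_iff _ (hins A hA hc).1 (hins A hA hc).2 d (Finset.mem_of_mem_erase hd),
      Finset.mem_insert, or_iff_right (Finset.ne_of_mem_erase hd)]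

end Restriction

/-- The extra unit of weight at `i` becomes an actual factor `ℓ i`. -/
theorem mul_linForm_mem_span_starMonomials {N : ℕ} {s : Finset ι} {ℓ : ι → Fin (N + 1) → K}
    {w : ι → ℕ} {q : ℕ} {i : ι} (hi : i ∈ s) {h : HCoordRing K N}
    (hh : h ∈ Ideal.span (starMonomials s ℓ (w + Pi.single i 1) q)) :
    h * linForm (ℓ i) ∈ Ideal.span (starMonomials s ℓ w q) := by
  induction hh using Submodule.span_induction with
  | mem x hx =>
    obtain ⟨a, ha, rfl⟩ := hx
    refine Ideal.subset_span ⟨a + Pi.single i 1, fun A hA hc => ?_, ?_⟩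
    · refine (ha A hA hc).trans (le_of_eq (Finset.sum_congr rfl fun j _ => ?_))
      simp only [Pi.add_apply]
      ring
    · simp only [Pi.add_apply, pow_add, Finset.prod_mul_distrib]
      congr 1
      rw [Finset.prod_eq_single i]
      · simp
      · intro j _ hj
        simp [hj]
      · exact fun h => absurd hi h
  | zero => simp
  | add x y _ _ hx hy =>
    rw [add_mul]
    exact add_mem hx hy
  | smul r x _ hx =>
    rw [smul_eq_mul, mul_assoc]
    exact Ideal.mul_mem_left _ _ hx

theorem exists_eq_mul_of_mem_span_singleton {σ : Type*} {l f : MvPolynomial σ K}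
    (hl : l.IsHomogeneous 1) (hl0 : l ≠ 0) {t : ℕ} (hf : f.IsHomogeneous t)
    (hmem : f ∈ Ideal.span {l}) : f = 0 ∨ ∃ e h, t = e + 1 ∧ h.IsHomogeneous e ∧ f = h * l := by
  rcases t with _ | t
  · left
    have := mem_of_mem_span_of_isHomogeneous (by simpa using ⟨1, hl⟩) hf hmem ⊥ ?_
    · simpa using this
    · rintro g rfl d e h hd - hde
      have := hd.inj_right hl hl0
      omega
  · right
    have := mem_of_mem_span_of_isHomogeneous (by simpa using ⟨1, hl⟩) hf hmem
      ((homogeneousSubmodule σ K t).map (LinearMap.mulRight K l)).toAddSubmonoid ?_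
    · obtain ⟨h, hh, rfl⟩ := this
      exact ⟨t, h, rfl, hh, rfl⟩
    · rintro g rfl d e h hd he hde
      have := hd.inj_right hl hl0
      obtain rfl : e = t := by omega
      exact ⟨h, he, rfl⟩

/-- Induction on the dimension, then on the degree. The restriction of `f` to one hyperplane is
handled by the smaller dimension and lifts to some `g` in the ideal; then `f - g` is divisible by
the form of that hyperplane, and the quotient has smaller degree. The weights `w` record the forms
already divided out, so that the statement reproduces itself. -/
theorem IsStar.mem_span_starMonomials {N : ℕ} {s : Finset ι} {ℓ : ι → Fin (N + 1) → K}
    {P : Finset ι → Fin (N + 1) → K} (h : IsStar s ℓ P) (hN : N ≤ s.card) (w : ι → ℕ) (q : ℕ)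
    {t : ℕ} {f : HCoordRing K N} (hf : f.IsHomogeneous t)
    (hv : ∀ A ⊆ s, A.card = N → VanishesTo (q - ∑ i ∈ A, w i) (P A) f) :
    f ∈ Ideal.span (starMonomials s ℓ w q) := by
  induction N generalizing s w q t with
  | zero =>
    have h0 := hv ∅ (by simp) (by simp)
    rw [Finset.sum_empty, Nat.sub_zero] at h0
    -- In dimension zero the only point is `P ∅`, and a form is a constant times a power of the
    -- single coordinate: it vanishes there only if it is zero.
    rcases Nat.eq_zero_or_pos q with rfl | hq
    · have : (1 : HCoordRing K 0) ∈ Ideal.span (starMonomials s ℓ w 0) :=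
        Ideal.subset_span ⟨0, by simp, by simp⟩
      rw [(Ideal.eq_top_iff_one _).mpr this]
      trivial
    · have h1 := vanishesTo_one_iff.mp (h0.mono hq)
      have hP : P ∅ 0 ≠ 0 := fun h2 =>
        h.ne_zero ∅ (by simp) (by simp) (funext fun j => by rw [Subsingleton.elim (α := Fin 1) j 0, h2]; rfl)
      have h2 : P ∅ = fun j => P ∅ 0 * (1 : Fin 1 → K) j := by
        funext j
        rw [Subsingleton.elim (α := Fin 1) j 0]
        simp
      have h3 : f = 0 := by
        have h4 : ∀ c : K, aeval (fun j : Fin 1 => c * (1 : Fin 1 → K) j) f =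
            c ^ t * aeval (1 : Fin 1 → K) f := fun c => aeval_smul_X_of_isHomogeneous hf c _
        have h5 : eval (P ∅) f = P ∅ 0 ^ t * eval (1 : Fin 1 → K) f := by
          have := h4 (P ∅ 0)
          rw [← h2] at this
          exact this
        have h6 : eval (1 : Fin 1 → K) f = 0 := by
          rw [h1] at h5
          exact (mul_eq_zero.mp h5.symm).resolve_left (pow_ne_zero _ hP)
        have h7 := aeval_smul_X_of_isHomogeneous hf (X 0 : HCoordRing K 0) (fun _ => 1)
        have h8 : (fun _ : Fin 1 => (X 0 : HCoordRing K 0) * 1) = X := by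
          funext j
          rw [Subsingleton.elim (α := Fin 1) j 0, mul_one]
        rw [h8, aeval_X_left, AlgHom.id_apply] at h7
        have h9 : aeval (fun _ => (1 : HCoordRing K 0)) f = C (eval (1 : Fin 1 → K) f) := by
          have : aeval (fun _ : Fin 1 => (1 : HCoordRing K 0)) f =
              (Algebra.ofId K (HCoordRing K 0)) (aeval (1 : Fin 1 → K) f) := by
            rw [← AlgHom.comp_apply, comp_aeval]
            congr 2
          rw [this]
          rfl
        rw [h7, h9, h6, C_0, mul_zero]
      rw [h3]
      exact zero_mem _
  | succ N ihN =>
    induction t using Nat.strong_induction_on generalizing f w with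
    | _ t iht =>
      -- The hyperplane must have minimal weight: monomials that avoid `ℓ i` are lifted below, and
      -- their order at points off this hyperplane is controlled by comparing weights.
      obtain ⟨i, hi, hmin⟩ := Finset.exists_min_image s w (Finset.card_pos.mp (by omega))
      have hℓ := h.form_ne_zero hi
      obtain ⟨p, hp⟩ := Function.ne_iff.mp hℓ
      have hres := h.restrict hi hp
      have hresf : (restrictTo (ℓ i) p f).IsHomogeneous t := by
        have := hf.aeval (fun j => linForm (hyperplaneCoord (ℓ i) p j))
          (fun j => linForm_isHomogeneous _)
        rw [one_mul] at this
        exact this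
      have hmem := ihN hres (by rw [Finset.card_erase_of_mem hi]; omega) w (q - w i) hresf
        (fun A hA hc => by
          have hiA : i ∉ A := fun h => Finset.notMem_erase i s (hA h)
          have hsub : insert i A ⊆ s := Finset.insert_subset hi (hA.trans (Finset.erase_subset _ _))
          have hcard : (insert i A).card = N + 1 := by rw [Finset.card_insert_of_notMem hiA, hc]
          have h1 := hv (insert i A) hsub hcard
          rw [Finset.sum_insert hiA, ← Nat.sub_sub] at h1
          exact h1.aeval_linForm (hyperplaneCoord (ℓ i) p) (hyperplaneCoord_dotProduct hp
            ((h.dotProduct_eq_zero_iff _ hsub hcard.le i hi).mpr (Finset.mem_insert_self _ _))))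
      -- Each monomial in the restricted forms lifts to the same monomial in the original ones, with
      -- exponent zero at `i`.
      obtain ⟨g, ⟨hgmem, hghom⟩, hgres⟩ := mem_of_mem_span_of_isHomogeneous
        (by rintro _ ⟨a, -, rfl⟩; exact ⟨_, isHomogeneous_prod_linForm_pow _ _ a⟩) hresf hmem
        (AddSubmonoid.map (restrictTo (ℓ i) p).toRingHom.toAddMonoidHom
          ((Ideal.span (starMonomials s ℓ w q)).toAddSubmonoid ⊓
            (homogeneousSubmodule _ K t).toAddSubmonoid)) (by
          rintro _ ⟨a, ha, rfl⟩ d e u hd hu hde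
          by_cases hzero : ∏ j ∈ s.erase i, linForm (restrictForm (ℓ i) p (ℓ j)) ^ a j = 0
          · rw [hzero, mul_zero]
            exact zero_mem _
          have hprod : ∏ j ∈ s, linForm (ℓ j) ^ (Function.update a i 0) j =
              ∏ j ∈ s.erase i, linForm (ℓ j) ^ a j := by
            rw [← Finset.mul_prod_erase s _ hi, Function.update_self, pow_zero, one_mul]
            refine Finset.prod_congr rfl fun j hj => ?_
            rw [Function.update_of_ne (Finset.ne_of_mem_erase hj)]
          refine ⟨rename p.succAbove u * ∏ j ∈ s, linForm (ℓ j) ^ (Function.update a i 0) j,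
            ⟨?_, ?_⟩, ?_⟩
          · refine Ideal.mul_mem_left _ _ (Ideal.subset_span ⟨_, fun A hA hc => ?_, rfl⟩)
            -- Remove one index `j` from `A`, choosing `i` itself if it occurs. The rest lies in
            -- `s.erase i` and contributes at least `q - w i`, while `j` contributes at least `w j ≥
            -- w i`.
            have hsum : ∀ j ∈ A, (i ∈ A → j = i) →
                (q - w i) + w i ≤ ∑ j ∈ A, (Function.update a i 0 j + w j) := by
              intro j hj hij
              have hsubset : A.erase j ⊆ s.erase i := by
                intro x hx
                refine Finset.mem_erase.mpr ⟨?_, hA (Finset.mem_of_mem_erase hx)⟩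
                rintro rfl
                exact Finset.ne_of_mem_erase hx (hij (Finset.mem_of_mem_erase hx)).symm
              have h1 := ha (A.erase j) hsubset (by rw [Finset.card_erase_of_mem hj]; omega)
              rw [← Finset.sum_erase_add A _ hj]
              refine add_le_add (h1.trans (Finset.sum_le_sum fun x hx => ?_))
                ((hmin j (hA hj)).trans (Nat.le_add_left _ _))
              rw [Function.update_of_ne (Finset.ne_of_mem_erase (hsubset hx))]
            have hex : ∃ j ∈ A, (i ∈ A → j = i) := by
              by_cases hiA : i ∈ A
              · exact ⟨i, hiA, fun _ => rfl⟩
              · obtain ⟨j, hj⟩ := Finset.card_pos.mp (show 0 < A.card by omega)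
                exact ⟨j, hj, fun h => absurd h hiA⟩
            obtain ⟨j, hj, hij⟩ := hex
            have := hsum j hj hij
            omega
          · have h1 := isHomogeneous_prod_linForm_pow (s.erase i)
              (fun j => restrictForm (ℓ i) p (ℓ j)) a
            have hda := hd.inj_right h1 hzero
            rw [hprod, ← hde, hda]
            exact (hu.rename_isHomogeneous).mul (isHomogeneous_prod_linForm_pow _ _ _)
          · change restrictTo (ℓ i) p _ = _
            rw [map_mul, restrictTo_rename, hprod, map_prod]
            simp only [map_pow, restrictTo_linForm])
      have hdiff : f - g ∈ Ideal.span {linForm (ℓ i)} := by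
        have h1 := sub_rename_restrictTo_mem hp (f - g)
        have h2 : restrictTo (ℓ i) p (f - g) = 0 := by
          rw [map_sub, sub_eq_zero]
          exact hgres.symm
        rwa [h2, map_zero, sub_zero] at h1
      rcases exists_eq_mul_of_mem_span_singleton (linForm_isHomogeneous (ℓ i))
        (fun h => hℓ (linForm_eq_zero_iff.mp h)) (hf.sub hghom) hdiff with h0 | ⟨e, u, rfl, hu, hfu⟩
      · rw [sub_eq_zero.mp h0]
        exact hgmem
      · rw [← sub_add_cancel f g, hfu]
        refine add_mem (mul_linForm_mem_span_starMonomials hi ?_) hgmem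
        -- The weight at `i` has gone up by one. At points on the hyperplane this is exactly the
        -- order lost in dividing by `ℓ i`; at the other points neither the order nor the
        -- requirement changes.
        refine iht e (by omega) _ hu fun A hA hc => ?_
        have h1 := (hv A hA hc).sub (starMonomials_vanishesTo h hgmem hA hc)
        rw [hfu] at h1
        simp only [Pi.add_apply, Finset.sum_add_distrib, Finset.sum_pi_single']
        split_ifs with hiA
        · rw [mul_comm] at h1
          rw [← Nat.sub_sub]
          exact h1.of_linForm_mul hℓ
        · rw [add_zero]
          rw [mul_comm] at h1
          refine h1.of_mul_left ?_
          rw [eval_linForm]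
          exact fun h2 => hiA ((h.dotProduct_eq_zero_iff A hA hc.le i hi).mp h2)

end Star

/-! ### From monomials in the linear forms to powers of the ideal of degree-`β` forms -/

section StarPowers

variable {K ι : Type*} [Field K]

theorem IsStar.prod_linForm_pow_ne_zero {N : ℕ} {s : Finset ι} {ℓ : ι → Fin (N + 1) → K}
    {P : Finset ι → Fin (N + 1) → K} (h : IsStar s ℓ P) (a : ι → ℕ) :
    ∏ i ∈ s, linForm (ℓ i) ^ a i ≠ 0 :=
  Finset.prod_ne_zero_iff.mpr fun _ hi =>
    pow_ne_zero _ fun h0 => h.form_ne_zero hi (linForm_eq_zero_iff.mp h0)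

variable [DecidableEq ι]

/-- The products of `β` distinct forms of a family of linear forms. -/
def starProducts {N : ℕ} (s : Finset ι) (ℓ : ι → Fin (N + 1) → K) (β : ℕ) : Set (HCoordRing K N) :=
  {g | ∃ T ⊆ s, T.card = β ∧ g = ∏ i ∈ T, linForm (ℓ i)}

/-- With at least `β` exponents above `m`, choose `T` among them: after the decrement they alone
contribute `m * β`. Otherwise let `T` contain all of them; then every drop in a capped exponent is
paid for by an element of `T`, so the total loss is at most `β`. -/
theorem exists_subset_sum_min_le (s : Finset ι) (β m : ℕ) (a : ι → ℕ)
    (h : (m + 1) * β ≤ ∑ i ∈ s, min (a i) (m + 1)) :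
    ∃ T ⊆ s, T.card = β ∧ (∀ i ∈ T, 1 ≤ a i) ∧
      m * β ≤ ∑ i ∈ s, min (a i - if i ∈ T then 1 else 0) m := by
  by_cases hc : β ≤ (s.filter fun i => m + 1 ≤ a i).card
  · obtain ⟨T, hT, hTc⟩ := Finset.exists_subset_card_eq hc
    have hTs : T ⊆ s := hT.trans (Finset.filter_subset _ _)
    have hTa : ∀ i ∈ T, m + 1 ≤ a i := fun i hi => (Finset.mem_filter.mp (hT hi)).2
    refine ⟨T, hTs, hTc, fun i hi => by have := hTa i hi; omega, ?_⟩
    refine le_trans ?_ (Finset.sum_le_sum_of_subset hTs)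
    rw [Finset.sum_congr rfl (g := fun _ => m), Finset.sum_const, smul_eq_mul, hTc, mul_comm]
    intro i hi
    have := hTa i hi
    simp only [hi, if_true]
    omega
  · have h1 : β ≤ (s.filter fun i => 1 ≤ a i).card := by
      have h2 : ∑ i ∈ s, min (a i) (m + 1) ≤ (m + 1) * (s.filter fun i => 1 ≤ a i).card := by
        rw [Finset.card_filter, Finset.mul_sum]
        refine Finset.sum_le_sum fun i _ => ?_
        split_ifs <;> omega
      exact Nat.le_of_mul_le_mul_left (h.trans h2) (by omega)
    obtain ⟨T, hT1, hT2, hTc⟩ := Finset.exists_subsuperset_card_eq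
      (show (s.filter fun i => m + 1 ≤ a i) ⊆ s.filter fun i => 1 ≤ a i from
        Finset.monotone_filter_right s fun i _ h => by omega) (by omega) h1
    have hTs : T ⊆ s := hT2.trans (Finset.filter_subset _ _)
    have hTa : ∀ i ∈ T, 1 ≤ a i := fun i hi => (Finset.mem_filter.mp (hT2 hi)).2
    refine ⟨T, hTs, hTc, hTa, ?_⟩
    have h3 : ∑ i ∈ s, min (a i) (m + 1) ≤
        ∑ i ∈ s, (min (a i - if i ∈ T then 1 else 0) m + if i ∈ T then 1 else 0) := by
      refine Finset.sum_le_sum fun i hi => ?_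
      split_ifs with hiT
      · omega
      · have : ¬ m + 1 ≤ a i := fun h => hiT (hT1 (Finset.mem_filter.mpr ⟨hi, h⟩))
        omega
    rw [Finset.sum_add_distrib, Finset.sum_ite_mem, Finset.inter_eq_right.mpr hTs,
      Finset.sum_const, smul_eq_mul, hTc] at h3
    have : (m + 1) * β = m * β + β := by ring
    omega

/-- Peel off products of `β` distinct forms one at a time. Exponents are capped at `m` because each
of the `m` products uses a given form at most once. -/
theorem prod_linForm_pow_mem {N : ℕ} (s : Finset ι) (ℓ : ι → Fin (N + 1) → K) (β m : ℕ)
    (a : ι → ℕ) (h : m * β ≤ ∑ i ∈ s, min (a i) m) :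
    ∏ i ∈ s, linForm (ℓ i) ^ a i ∈ Ideal.span (starProducts s ℓ β) ^ m := by
  induction m generalizing a with
  | zero => simp
  | succ m ih =>
    obtain ⟨T, hTs, hTc, hTa, hT⟩ := exists_subset_sum_min_le s β m a h
    have key : ∏ i ∈ s, linForm (ℓ i) ^ a i =
        (∏ i ∈ s, linForm (ℓ i) ^ (a i - if i ∈ T then 1 else 0)) * ∏ i ∈ T, linForm (ℓ i) := by
      rw [← Finset.inter_eq_right.mpr hTs, ← Finset.prod_ite_mem, ← Finset.prod_mul_distrib]
      refine Finset.prod_congr rfl fun i hi => ?_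
      by_cases hiT : i ∈ T
      · simp only [Finset.mem_inter, hi, hiT, and_true, if_true]
        rw [pow_sub_one_mul (by have := hTa i hiT; omega)]
      · simp [hiT]
    rw [key, pow_succ]
    exact Ideal.mul_mem_mul (ih _ hT) (Ideal.subset_span ⟨T, hTs, hTc, rfl⟩)

/-- The points `P (T.erase i)` form a dual family up to nonzero scalars, so any `N + 1` of the
linear forms are independent and hence a basis. -/
theorem IsStar.mem_span_image_linForm {N : ℕ} {s : Finset ι} {ℓ : ι → Fin (N + 1) → K}
    {P : Finset ι → Fin (N + 1) → K} (h : IsStar s ℓ P) {T : Finset ι} (hT : T ⊆ s)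
    (hc : T.card = N + 1) (j : Fin (N + 1)) :
    (X j : HCoordRing K N) ∈ Ideal.span ((fun i => linForm (ℓ i)) '' (T : Set ι)) := by
  have hsub : ∀ i : T, T.erase i ⊆ s := fun i => (Finset.erase_subset _ _).trans hT
  have hcard : ∀ i : T, (T.erase i).card ≤ N := fun i => by
    rw [Finset.card_erase_of_mem i.2, hc, Nat.add_sub_cancel]
  have hli : LinearIndependent K fun i : T => ℓ i := by
    rw [Fintype.linearIndependent_iff]
    intro c hsum i
    have h1 := congrArg (fun v => v ⬝ᵥ P (T.erase i)) hsum
    simp only [sum_dotProduct, smul_dotProduct, zero_dotProduct, smul_eq_mul] at h1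
    rw [Finset.sum_eq_single i] at h1
    · refine (mul_eq_zero.mp h1).resolve_right fun h2 => ?_
      exact Finset.notMem_erase _ _
        ((h.dotProduct_eq_zero_iff _ (hsub i) (hcard i) i (hT i.2)).mp h2)
    · intro k _ hk
      rw [(h.dotProduct_eq_zero_iff _ (hsub i) (hcard i) k (hT k.2)).mpr
        (Finset.mem_erase.mpr ⟨fun h => hk (Subtype.ext h), k.2⟩), mul_zero]
    · simp
  have : Nonempty T := (Finset.card_pos.mp (by omega)).to_subtype
  have hspan : Submodule.span K (Set.range fun i : T => ℓ i) = ⊤ :=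
    hli.span_eq_top_of_card_eq_finrank (by simp [hc])
  have hj : (Pi.single j 1 : Fin (N + 1) → K) ∈ Submodule.span K (Set.range fun i : T => ℓ i) := by
    rw [hspan]
    trivial
  obtain ⟨c, hcj⟩ := (Submodule.mem_span_range_iff_exists_fun K).mp hj
  have : (X j : HCoordRing K N) = ∑ i : T, C (c i) * linForm (ℓ i) := by
    rw [← linForm_single, ← hcj]
    simp only [linForm, Finset.sum_apply, Pi.smul_apply, smul_eq_mul, map_sum, C_mul,
      Finset.sum_mul, Finset.mul_sum]
    rw [Finset.sum_comm]
    simp only [mul_assoc]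
  rw [this]
  exact sum_mem fun i _ => Ideal.mul_mem_left _ _ (Ideal.subset_span ⟨i, i.2, rfl⟩)

/-- Enclose the exponents below `m` in a set of size `N`. That set contributes at least `m`, and
each of the `β - 1` remaining indices contributes `m`. -/
theorem mul_min_le_sum_min {s : Finset ι} {N β m : ℕ} (hs : s.card + 1 = β + N) (hβ : 1 ≤ β)
    {a : ι → ℕ} (ha : ∀ A ⊆ s, A.card = N → m ≤ ∑ i ∈ A, a i)
    (hc : (s.filter fun i => a i < m).card ≤ N) : m * β ≤ ∑ i ∈ s, min (a i) m := by
  obtain ⟨A, hA1, hA2, hAc⟩ := Finset.exists_subsuperset_card_eq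
    (Finset.filter_subset (fun i => a i < m) s) hc (by omega)
  have h1 : m ≤ ∑ i ∈ A, min (a i) m := by
    by_cases hex : ∃ i ∈ A, m ≤ a i
    · obtain ⟨i, hi, him⟩ := hex
      calc m = min (a i) m := by omega
        _ ≤ _ := Finset.single_le_sum (f := fun i => min (a i) m) (fun _ _ => Nat.zero_le _) hi
    · push Not at hex
      refine (ha A hA2 hAc).trans (le_of_eq (Finset.sum_congr rfl fun i hi => ?_))
      have := hex i hi
      omega
  have h2 : ∑ i ∈ s \ A, min (a i) m = (s \ A).card * m := by
    rw [← smul_eq_mul, ← Finset.sum_const]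
    refine Finset.sum_congr rfl fun i hi => ?_
    rw [Finset.mem_sdiff] at hi
    have : ¬ a i < m := fun h => hi.2 (hA1 (Finset.mem_filter.mpr ⟨hi.1, h⟩))
    omega
  rw [← Finset.sum_sdiff hA2, h2, Finset.card_sdiff_of_subset hA2, hAc]
  obtain ⟨b, rfl⟩ : ∃ b, β = b + 1 := ⟨β - 1, by omega⟩
  rw [show s.card - N = b by omega, mul_add, mul_one, mul_comm m b]
  omega

theorem prod_linForm_pow_add_single {N : ℕ} {s : Finset ι} (ℓ : ι → Fin (N + 1) → K) (a : ι → ℕ)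
    {i : ι} (hi : i ∈ s) : ∏ j ∈ s, linForm (ℓ j) ^ (a + Pi.single i 1 : ι → ℕ) j =
      linForm (ℓ i) * ∏ j ∈ s, linForm (ℓ j) ^ a j := by
  simp only [Pi.add_apply, pow_add, Finset.prod_mul_distrib]
  rw [mul_comm]
  congr 1
  rw [Finset.prod_eq_single i]
  · simp
  · intro j _ hj
    simp [hj]
  · exact fun h => absurd hi h

/-- Induction on the deficit `D` of the capped exponent sum. While it is positive, more than `N`
exponents are below `m`, and `N + 1` of the corresponding forms generate `M`. A spare linear factor
is rewritten in terms of these forms, which raises a deficient exponent and lowers `D`. -/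
theorem IsStar.mul_prod_mem {N : ℕ} {s : Finset ι} {ℓ : ι → Fin (N + 1) → K}
    {P : Finset ι → Fin (N + 1) → K} (h : IsStar s ℓ P) {β m : ℕ} (hs : s.card + 1 = β + N)
    (hβ : 1 ≤ β) {a : ι → ℕ} (ha : ∀ A ⊆ s, A.card = N → m ≤ ∑ i ∈ A, a i) {j : ℕ}
    (hj : m * β ≤ ∑ i ∈ s, a i + j) {u : HCoordRing K N} (hu : u ∈ irrelevantIdeal K N ^ j) :
    u * ∏ i ∈ s, linForm (ℓ i) ^ a i ∈ Ideal.span (starProducts s ℓ β) ^ m := by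
  obtain ⟨D, hD⟩ : ∃ D, D = m * β - ∑ i ∈ s, min (a i) m := ⟨_, rfl⟩
  induction D using Nat.strong_induction_on generalizing a j u with
  | _ D ih =>
    by_cases hc : (s.filter fun i => a i < m).card ≤ N
    · exact Ideal.mul_mem_left _ _
        (prod_linForm_pow_mem s ℓ β m a (mul_min_le_sum_min hs hβ ha hc))
    by_cases hfull : m * β ≤ ∑ i ∈ s, min (a i) m
    · exact Ideal.mul_mem_left _ _ (prod_linForm_pow_mem s ℓ β m a hfull)
    push Not at hc hfull
    obtain ⟨T, hT, hTc⟩ := Finset.exists_subset_card_eq (show N + 1 ≤ _ from hc)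
    have hTs : T ⊆ s := hT.trans (Finset.filter_subset _ _)
    have hTm : ∀ i ∈ T, a i < m := fun i hi => (Finset.mem_filter.mp (hT hi)).2
    have hM : irrelevantIdeal K N ≤ Ideal.span ((fun i => linForm (ℓ i)) '' (T : Set ι)) := by
      refine Ideal.span_le.mpr ?_
      rintro _ ⟨k, rfl⟩
      exact h.mem_span_image_linForm hTs hTc k
    have step : ∀ b : ι → ℕ, ∀ v y : HCoordRing K N,
        (∀ i ∈ T, v * ∏ k ∈ s, linForm (ℓ k) ^ (b + Pi.single i 1 : ι → ℕ) k ∈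
          Ideal.span (starProducts s ℓ β) ^ m) → y ∈ irrelevantIdeal K N →
        v * y * ∏ k ∈ s, linForm (ℓ k) ^ b k ∈ Ideal.span (starProducts s ℓ β) ^ m := by
      intro b v y hv hy
      refine Submodule.span_induction ?_ ?_ ?_ ?_ (hM hy)
      · rintro _ ⟨i, hi, rfl⟩
        have := hv i hi
        rwa [prod_linForm_pow_add_single ℓ b (hTs hi), ← mul_assoc] at this
      · simp
      · intro x y _ _ hx hy
        rw [mul_add, add_mul]
        exact add_mem hx hy
      · intro r x _ hx
        rw [smul_eq_mul, mul_left_comm, mul_assoc]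
        exact Ideal.mul_mem_left _ _ hx
    have hsum : ∀ b : ι → ℕ, ∀ i ∈ s,
        ∑ k ∈ s, (b + Pi.single i 1 : ι → ℕ) k = ∑ k ∈ s, b k + 1 := by
      intro b i hi
      simp only [Pi.add_apply, Finset.sum_add_distrib, Finset.sum_pi_single', hi, if_true]
    rcases j with _ | j
    -- When `u` supplies no more linear factors, the degree bound forces some exponent above `m`;
    -- one copy of that form is the spare factor. Its exponent stays at least `m`, so the order
    -- condition survives.
    · obtain ⟨i₀, hi₀, hlt⟩ : ∃ i ∈ s, min (a i) m < a i := by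
        by_contra! hall
        have := Finset.sum_le_sum hall
        omega
      have hi₀m : m < a i₀ := by omega
      set b : ι → ℕ := Function.update a i₀ (a i₀ - 1) with hb
      have hab : a = b + Pi.single i₀ 1 := by
        funext k
        by_cases hk : k = i₀
        · subst hk
          simp only [hb, Pi.add_apply, Function.update_self, Pi.single_eq_same]
          omega
        · simp [hb, hk]
      have hbm : ∀ k, min (b k) m = min (a k) m := by
        intro k
        by_cases hk : k = i₀
        · subst hk
          simp only [hb, Function.update_self]
          omega
        · simp [hb, hk]
      have hrw : u * ∏ i ∈ s, linForm (ℓ i) ^ a i =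
          u * linForm (ℓ i₀) * ∏ k ∈ s, linForm (ℓ k) ^ b k := by
        conv_lhs => rw [hab, prod_linForm_pow_add_single ℓ b hi₀]
        ring
      rw [hrw]
      refine step b u _ (fun i hi => ?_) ?_
      · refine ih _ ?_ (fun A hA hAc => ?_) (j := 0) ?_ hu rfl
        · rw [hD]
          have : ∑ k ∈ s, min (a k) m < ∑ k ∈ s, min ((b + Pi.single i 1 : ι → ℕ) k) m := by
            refine Finset.sum_lt_sum (fun k _ => ?_) ⟨i, hTs hi, ?_⟩
            · rw [← hbm, Pi.add_apply]
              omega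
            · have h1 := hTm i hi
              have h2 := hbm i
              simp only [Pi.add_apply, Pi.single_eq_same]
              omega
          omega
        · by_cases hi₀A : i₀ ∈ A
          · have h1 : m ≤ (b + Pi.single i 1 : ι → ℕ) i₀ := by
              simp only [hb, Pi.add_apply, Function.update_self]
              omega
            exact h1.trans (Finset.single_le_sum (f := (b + Pi.single i 1 : ι → ℕ))
              (fun _ _ => Nat.zero_le _) hi₀A)
          · refine (ha A hA hAc).trans (Finset.sum_le_sum fun k hk => ?_)
            have : k ≠ i₀ := fun h => hi₀A (h ▸ hk)
            simp [hb, this]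
        · rw [hsum b i (hTs hi), ← hsum b i₀ hi₀, ← hab]
          exact hj
      · rw [linForm]
        exact sum_mem fun k _ => Ideal.mul_mem_left _ _ (Ideal.subset_span ⟨k, rfl⟩)
    · rw [pow_succ] at hu
      refine Submodule.mul_induction_on hu (fun v hv y hy => ?_) fun x y hx hy => ?_
      · refine step a v y (fun i hi => ih _ ?_ (fun A hA hAc => ?_) ?_ hv rfl) hy
        · rw [hD]
          have : ∑ k ∈ s, min (a k) m < ∑ k ∈ s, min ((a + Pi.single i 1 : ι → ℕ) k) m := by
            refine Finset.sum_lt_sum (fun k _ => ?_) ⟨i, hTs hi, ?_⟩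
            · rw [Pi.add_apply]
              omega
            · have h1 := hTm i hi
              simp only [Pi.add_apply, Pi.single_eq_same]
              omega
          omega
        · exact (ha A hA hAc).trans (Finset.sum_le_sum fun k _ => Nat.le_add_right _ _)
        · rw [hsum a i (hTs hi)]
          omega
      · rw [add_mul]
        exact add_mem hx hy

theorem mem_irrelevantIdeal_pow {N e : ℕ} {f : HCoordRing K N} (hf : f.IsHomogeneous e) :
    f ∈ irrelevantIdeal K N ^ e := by
  change f ∈ idealOfVars (Fin (N + 1)) K ^ e
  rw [mem_pow_idealOfVars_iff']
  intro x hx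
  exact hf.coeff_eq_zero (by omega)

/-- In degree at least `m β`, the `m`-th symbolic power of the ideal of a star configuration is
contained in the `m`-th power of the ideal of its forms of degree `β`. -/
theorem IsStar.mem_span_starProducts_pow {N : ℕ} {s : Finset ι} {ℓ : ι → Fin (N + 1) → K}
    {P : Finset ι → Fin (N + 1) → K} (h : IsStar s ℓ P) {β m t : ℕ} (hs : s.card + 1 = β + N)
    (hβ : 1 ≤ β) (ht : m * β ≤ t) {f : HCoordRing K N} (hf : f.IsHomogeneous t)
    (hv : ∀ A ⊆ s, A.card = N → VanishesTo m (P A) f) :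
    f ∈ Ideal.span (starProducts s ℓ β) ^ m := by
  have hmem := h.mem_span_starMonomials (by omega) 0 m hf (by simpa using hv)
  refine mem_of_mem_span_of_isHomogeneous
    (by rintro _ ⟨a, -, rfl⟩; exact ⟨_, isHomogeneous_prod_linForm_pow _ _ a⟩) hf hmem
    (Ideal.span (starProducts s ℓ β) ^ m).toAddSubmonoid ?_
  rintro _ ⟨a, ha, rfl⟩ d e u hd hu hde
  have hda := hd.inj_right (isHomogeneous_prod_linForm_pow s ℓ a) (h.prod_linForm_pow_ne_zero a)
  exact h.mul_prod_mem hs hβ (by simpa using ha) (by omega) (mem_irrelevantIdeal_pow hu)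

/-- Forms vanishing to order `N m` at the points of a star configuration of `s` hyperplanes have
degree at least `s m`. -/
theorem IsStar.eq_zero_of_vanishesTo {N : ℕ} {s : Finset ι} {ℓ : ι → Fin (N + 1) → K}
    {P : Finset ι → Fin (N + 1) → K} (h : IsStar s ℓ P) {m t : ℕ} (hN : 1 ≤ N) (hs : N ≤ s.card)
    (ht : t < m * s.card) {f : HCoordRing K N} (hf : f.IsHomogeneous t)
    (hv : ∀ A ⊆ s, A.card = N → VanishesTo (N * m) (P A) f) : f = 0 := by
  have hmem := h.mem_span_starMonomials hs 0 (N * m) hf (by simpa using hv)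
  have := mem_of_mem_span_of_isHomogeneous
    (by rintro _ ⟨a, -, rfl⟩; exact ⟨_, isHomogeneous_prod_linForm_pow _ _ a⟩) hf hmem ⊥ ?_
  · simpa using this
  rintro _ ⟨a, ha, rfl⟩ d e u hd hu hde
  exfalso
  have hda := hd.inj_right (isHomogeneous_prod_linForm_pow s ℓ a) (h.prod_linForm_pow_ne_zero a)
  simp only [Pi.zero_apply, add_zero] at ha
  -- `N` exponents below `m` would have sum below `N m`. Hence there are fewer than `N` of them;
  -- enclosed in a set of size `N`, they leave outside only exponents at least `m`.
  have hc : (s.filter fun i => a i < m).card ≤ N := by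
    by_contra! hc
    obtain ⟨A, hA, hAc⟩ := Finset.exists_subset_card_eq hc.le
    have h1 := ha A (hA.trans (Finset.filter_subset _ _)) hAc
    have h2 : ∑ i ∈ A, a i < ∑ _i ∈ A, m :=
      Finset.sum_lt_sum_of_nonempty (Finset.card_pos.mp (by omega))
        fun i hi => (Finset.mem_filter.mp (hA hi)).2
    rw [Finset.sum_const, hAc, smul_eq_mul] at h2
    omega
  obtain ⟨A, hA1, hA2, hAc⟩ := Finset.exists_subsuperset_card_eq
    (Finset.filter_subset (fun i => a i < m) s) hc hs
  have h1 := ha A hA2 hAc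
  have h2 : ∑ _i ∈ s \ A, m ≤ ∑ i ∈ s \ A, a i := by
    refine Finset.sum_le_sum fun i hi => ?_
    rw [Finset.mem_sdiff] at hi
    by_contra! hlt
    exact hi.2 (hA1 (Finset.mem_filter.mpr ⟨hi.1, hlt⟩))
  rw [Finset.sum_const, Finset.card_sdiff_of_subset hA2, hAc, smul_eq_mul] at h2
  have h3 := Finset.sum_sdiff (f := a) hA2
  have h4 : m * s.card = (s.card - N) * m + N * m := by
    rw [← add_mul, Nat.sub_add_cancel hs, mul_comm]
  omega

end StarPowers

/-! ### Openness of exactness -/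

section Exactness

/-- Choose linear `s` with `D s D = D`. Then `1 - s D` maps into `ker D`, hence into the range of
`B`, and so factors through `B`. -/
theorem exists_mul_add_mul_eq_one {k κ ν μ : Type*} [Field k] [Fintype κ] [Fintype ν] [Fintype μ]
    [DecidableEq κ] [DecidableEq ν] [DecidableEq μ] (D : Matrix κ ν k) (B : Matrix ν μ k)
    (h : ∀ v, D.mulVec v = 0 → ∃ u, B.mulVec u = v) :
    ∃ (P : Matrix ν κ k) (Q : Matrix μ ν k), P * D + B * Q = 1 := by
  set d := Matrix.toLin' D with hd
  set b := Matrix.toLin' B with hb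
  obtain ⟨r, hr⟩ := d.rangeRestrict.exists_rightInverse_of_surjective d.range_rangeRestrict
  obtain ⟨s, hs⟩ := LinearMap.exists_extend r
  have hsd : ∀ x, d (s (d x)) = d x := by
    intro x
    have h1 : s (d x) = r ⟨d x, LinearMap.mem_range_self d x⟩ := DFunLike.congr_fun hs ⟨d x, _⟩
    have h2 := DFunLike.congr_fun hr ⟨d x, LinearMap.mem_range_self d x⟩
    rw [h1]
    exact congrArg Subtype.val h2
  obtain ⟨e, he⟩ := b.rangeRestrict.exists_rightInverse_of_surjective b.range_rangeRestrict
  have hmem : ∀ x, ((LinearMap.id : (ν → k) →ₗ[k] ν → k) - s.comp d) x ∈ LinearMap.range b := by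
    intro x
    obtain ⟨u, hu⟩ := h (x - s (d x)) (by
      rw [← Matrix.toLin'_apply, ← hd, map_sub, hsd, sub_self])
    exact ⟨u, by rw [hb, Matrix.toLin'_apply, hu]; rfl⟩
  set Q := e.comp (((LinearMap.id : (ν → k) →ₗ[k] ν → k) - s.comp d).codRestrict (LinearMap.range b) hmem) with hQ
  refine ⟨LinearMap.toMatrix' s, LinearMap.toMatrix' Q, ?_⟩
  apply Matrix.toLin'.injective
  rw [map_add, Matrix.toLin'_mul, Matrix.toLin'_mul, Matrix.toLin'_toMatrix',
    Matrix.toLin'_toMatrix', Matrix.toLin'_one, ← hd, ← hb]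
  refine LinearMap.ext fun x => ?_
  have h1 := congrArg Subtype.val (DFunLike.congr_fun he ⟨_, hmem x⟩)
  have h2 : b (Q x) = x - s (d x) := h1
  rw [LinearMap.add_apply, LinearMap.comp_apply, LinearMap.comp_apply, h2, LinearMap.id_apply]
  abel

/-- The invertible matrix `P D + B Q` preserves `ker D`, so by finite dimension it is surjective
there; on `ker D` it equals `B Q`. -/
theorem exists_mulVec_eq_of_det_ne_zero {L κ ν μ : Type*} [Field L] [Fintype κ] [Fintype ν]
    [Fintype μ] [DecidableEq ν] (D : Matrix κ ν L) (B : Matrix ν μ L) (P : Matrix ν κ L)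
    (Q : Matrix μ ν L) (hDB : D * B = 0) (hdet : (P * D + B * Q).det ≠ 0) (v : ν → L)
    (hv : D.mulVec v = 0) : ∃ u, B.mulVec u = v := by
  have hW : ∀ x ∈ LinearMap.ker D.mulVecLin,
      (P * D + B * Q).mulVecLin x ∈ LinearMap.ker D.mulVecLin := by
    intro x hx
    rw [LinearMap.mem_ker, Matrix.mulVecLin_apply] at hx ⊢
    rw [Matrix.mulVecLin_apply, Matrix.add_mulVec, ← Matrix.mulVec_mulVec, hx, Matrix.mulVec_zero,
      zero_add, Matrix.mulVec_mulVec, ← Matrix.mul_assoc, hDB, Matrix.zero_mul, Matrix.zero_mulVec]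
  have hinj : Function.Injective ((P * D + B * Q).mulVecLin.restrict hW) := by
    rw [← LinearMap.ker_eq_bot, LinearMap.ker_eq_bot']
    rintro ⟨x, hx⟩ h
    have h1 : (P * D + B * Q).mulVec x = 0 := congrArg Subtype.val h
    refine Subtype.ext ?_
    by_contra hx0
    exact hdet (Matrix.exists_mulVec_eq_zero_iff.mp ⟨x, hx0, h1⟩)
  obtain ⟨⟨x, hx⟩, hxv⟩ := LinearMap.injective_iff_surjective.mp hinj ⟨v, hv⟩
  have h1 : (P * D + B * Q).mulVec x = v := congrArg Subtype.val hxv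
  rw [LinearMap.mem_ker, Matrix.mulVecLin_apply] at hx
  rw [Matrix.add_mulVec, ← Matrix.mulVec_mulVec, hx, Matrix.mulVec_zero, zero_add,
    ← Matrix.mulVec_mulVec] at h1
  exact ⟨_, h1⟩

/-- If a complex of matrices over a `k`-algebra becomes exact at a `k`-point, it is exact at all
field-valued points of a neighbourhood of that point. -/
theorem exists_exact_neighbourhood {k A κ ν μ : Type*} [Field k] [CommRing A] [Algebra k A]
    [Fintype κ] [Fintype ν] [Fintype μ] (ρ₀ : A →ₐ[k] k) (D : Matrix κ ν A) (B : Matrix ν μ A)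
    (hDB : D * B = 0)
    (h : ∀ v, (D.map ρ₀).mulVec v = 0 → ∃ u, (B.map ρ₀).mulVec u = v) :
    ∃ g : A, ρ₀ g ≠ 0 ∧ ∀ (L : Type*) [Field L] (ρ : A →+* L), ρ g ≠ 0 →
      ∀ v, (D.map ρ).mulVec v = 0 → ∃ u, (B.map ρ).mulVec u = v := by
  classical
  obtain ⟨P, Q, hPQ⟩ := exists_mul_add_mul_eq_one _ _ h
  refine ⟨(P.map (algebraMap k A) * D + B * Q.map (algebraMap k A)).det, ?_, ?_⟩
  · have hmap : (P.map (algebraMap k A) * D + B * Q.map (algebraMap k A)).map ρ₀ = 1 := by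
      rw [← hPQ, Matrix.map_add _ (map_add ρ₀), Matrix.map_mul, Matrix.map_mul, Matrix.map_map,
        Matrix.map_map]
      congr 2 <;> ext <;> simp
    have := AlgHom.map_det ρ₀ (P.map (algebraMap k A) * D + B * Q.map (algebraMap k A))
    rw [this, AlgHom.mapMatrix_apply, hmap, Matrix.det_one]
    exact one_ne_zero
  · intro L _ ρ hg v hv
    rw [RingHom.map_det, RingHom.mapMatrix_apply, Matrix.map_add _ (map_add ρ), Matrix.map_mul,
      Matrix.map_mul] at hg
    refine exists_mulVec_eq_of_det_ne_zero _ _ _ _ ?_ hg v hv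
    rw [← Matrix.map_mul, hDB]
    ext
    simp

end Exactness

/-! ### Forms vanishing at moving points -/

section MovingPoints

variable {N : ℕ}

/-- The exponents of the monomials of degree `t`. -/
abbrev FormExponent (N t : ℕ) : Type :=
  {a : Fin (N + 1) →₀ ℕ // a ∈ (Finset.univ : Finset (Fin (N + 1))).finsuppAntidiag t}

theorem mem_finsuppAntidiag_univ_iff {t : ℕ} {a : Fin (N + 1) →₀ ℕ} :
    a ∈ (Finset.univ : Finset (Fin (N + 1))).finsuppAntidiag t ↔ a.degree = t := by
  rw [Finset.mem_finsuppAntidiag, Finsupp.degree_eq_sum]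
  simp

theorem eq_sum_formExponent {R : Type*} [CommRing R] {t : ℕ} {f : MvPolynomial (Fin (N + 1)) R}
    (hf : f.IsHomogeneous t) : f = ∑ a : FormExponent N t, C (coeff a.1 f) * monomial a.1 1 := by
  ext b
  simp only [C_mul_monomial, mul_one, coeff_sum, coeff_monomial]
  by_cases hb : b.degree = t
  · rw [Finset.sum_eq_single ⟨b, mem_finsuppAntidiag_univ_iff.mpr hb⟩]
    · simp
    · rintro ⟨c, hc⟩ _ hne
      rw [if_neg fun h => hne (Subtype.ext h)]
    · simp
  · rw [hf.coeff_eq_zero hb]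
    refine (Finset.sum_eq_zero ?_).symm
    rintro ⟨c, hc⟩ _
    rw [if_neg]
    rintro rfl
    exact hb (mem_finsuppAntidiag_univ_iff.mp hc)

/-- The order conditions are linear in the coefficients of `f`, with matrix entries defined over `A`
and so independent of the specialization `ρ`. -/
theorem coeff_taylorAt_eq_sum {A S : Type*} [CommRing A] [CommRing S] (ρ : A →+* S)
    (z : Fin (N + 1) → A) {t : ℕ} {f : MvPolynomial (Fin (N + 1)) S} (hf : f.IsHomogeneous t)
    (d : ℕ) (b : Fin (N + 1) →₀ ℕ) :
    coeff b ((taylorAt (ρ ∘ z) f).coeff d) =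
      ∑ a : FormExponent N t,
        ρ (coeff b ((taylorAt z (monomial a.1 1)).coeff d)) * coeff a.1 f := by
  conv_lhs => rw [eq_sum_formExponent hf]
  rw [map_sum, Polynomial.finsetSum_coeff, coeff_sum]
  refine Finset.sum_congr rfl fun a _ => ?_
  have : (monomial a.1 1 : MvPolynomial (Fin (N + 1)) S) = map ρ (monomial a.1 1) := by simp
  rw [map_mul, taylorAt_C, this, taylorAt_map, Polynomial.coeff_C_mul, coeff_C_mul,
    Polynomial.coeff_map, coeff_map, mul_comm]

section Matrices

variable {A μ : Type*} [CommRing A] {n : ℕ}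

/-- The exponents occurring in the expansions of the monomials of degree `t` around the points `z`,
up to order `q`. -/
def vanishingSupport (z : Fin n → Fin (N + 1) → A) (q t : ℕ) : Finset (Fin (N + 1) →₀ ℕ) :=
  open scoped Classical in
  Finset.univ.biUnion fun x : Fin n × Fin q × FormExponent N t =>
    ((taylorAt (z x.1) (monomial x.2.2.1 1)).coeff x.2.1).support

/-- The matrix of the linear conditions for a form of degree `t` to vanish to order `q` at the
points `z`. -/
def vanishingMatrix (z : Fin n → Fin (N + 1) → A) (q t : ℕ) :
    Matrix (Fin n × Fin q × vanishingSupport z q t) (FormExponent N t) A :=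
  Matrix.of fun x a => coeff x.2.2.1 ((taylorAt (z x.1) (monomial a.1 1)).coeff x.2.1)

/-- The matrix of the coefficients of a family of forms of degree `t`. -/
def coeffMatrix (b : μ → MvPolynomial (Fin (N + 1)) A) (t : ℕ) : Matrix (FormExponent N t) μ A :=
  Matrix.of fun a u => coeff a.1 (b u)

variable {S : Type*} [CommRing S]

theorem vanishesTo_iff_vanishingMatrix_mulVec (z : Fin n → Fin (N + 1) → A) (q : ℕ) {t : ℕ}
    (ρ : A →+* S) {f : MvPolynomial (Fin (N + 1)) S} (hf : f.IsHomogeneous t) :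
    (∀ i, VanishesTo q (ρ ∘ z i) f) ↔
      ((vanishingMatrix z q t).map ρ).mulVec (fun a => coeff a.1 f) = 0 := by
  constructor
  · intro hv
    funext ⟨i, d, c⟩
    have := Polynomial.X_pow_dvd_iff.mp (hv i) d d.2
    rw [Pi.zero_apply, ← coeff_zero c.1, ← this, coeff_taylorAt_eq_sum ρ (z i) hf]
    rfl
  · intro hv i
    refine Polynomial.X_pow_dvd_iff.mpr fun d hd => ?_
    ext c
    rw [coeff_taylorAt_eq_sum ρ (z i) hf, coeff_zero]
    by_cases hc : c ∈ vanishingSupport z q t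
    · exact congrFun hv (i, ⟨d, hd⟩, ⟨c, hc⟩)
    -- Exponents outside the support give identically zero conditions, so finitely many rows
    -- suffice.
    · refine Finset.sum_eq_zero fun a _ => ?_
      have : coeff c ((taylorAt (z i) (monomial a.1 1)).coeff d) = 0 := by
        by_contra hne
        exact hc (Finset.mem_biUnion.mpr
          ⟨(i, ⟨d, hd⟩, a), Finset.mem_univ _, mem_support_iff.mpr hne⟩)
      rw [this, map_zero, zero_mul]

variable [Fintype μ]

theorem coeffMatrix_mulVec (b : μ → MvPolynomial (Fin (N + 1)) A) (t : ℕ) (ρ : A →+* S)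
    (c : μ → S) : ((coeffMatrix b t).map ρ).mulVec c =
      fun a => coeff a.1 (∑ u, c u • map ρ (b u)) := by
  funext a
  simp only [Matrix.mulVec, dotProduct, coeffMatrix, coeff_sum, Matrix.map_apply, Matrix.of_apply,
    coeff_smul, smul_eq_mul, coeff_map]
  exact Finset.sum_congr rfl fun u _ => mul_comm _ _

theorem isHomogeneous_sum_smul_map {b : μ → MvPolynomial (Fin (N + 1)) A} {t : ℕ}
    (hb : ∀ u, (b u).IsHomogeneous t) (ρ : A →+* S) (c : μ → S) :
    (∑ u, c u • map ρ (b u)).IsHomogeneous t := by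
  refine IsHomogeneous.sum _ _ _ fun u _ => ?_
  rw [smul_eq_C_mul]
  exact ((hb u).map ρ).C_mul _

theorem exists_form_of_coeff {t : ℕ} (v : FormExponent N t → S) :
    ∃ f : MvPolynomial (Fin (N + 1)) S, f.IsHomogeneous t ∧ (fun a => coeff a.1 f) = v := by
  refine ⟨∑ a : FormExponent N t, C (v a) * monomial a.1 1, IsHomogeneous.sum _ _ _ fun a _ =>
      (isHomogeneous_monomial 1 (mem_finsuppAntidiag_univ_iff.mp a.2)).C_mul _, ?_⟩
  funext a
  simp only [C_mul_monomial, mul_one, coeff_sum, coeff_monomial]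
  rw [Finset.sum_eq_single a]
  · simp
  · intro c _ hne
    rw [if_neg fun h => hne (Subtype.ext h)]
  · simp

theorem eq_of_coeff_eq {t : ℕ} {f g : MvPolynomial (Fin (N + 1)) S} (hf : f.IsHomogeneous t)
    (hg : g.IsHomogeneous t)
    (h : (fun a : FormExponent N t => coeff a.1 f) = fun a => coeff a.1 g) : f = g := by
  rw [eq_sum_formExponent hf, eq_sum_formExponent hg]
  refine Finset.sum_congr rfl fun a _ => ?_
  rw [congrFun h a]

end Matrices

/-- This is openness of exactness for the generators followed by the vanishing conditions. That the
`b u` vanish to order `q` already over `A` is what makes it a complex. -/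
theorem exists_mem_span_neighbourhood {k A μ : Type*} [Field k] [CommRing A] [Algebra k A]
    [Fintype μ] {n q t : ℕ} (ρ₀ : A →ₐ[k] k) (z : Fin n → Fin (N + 1) → A)
    (b : μ → MvPolynomial (Fin (N + 1)) A) (hb : ∀ u, (b u).IsHomogeneous t)
    (hbz : ∀ u i, VanishesTo q (z i) (b u))
    (h : ∀ f : MvPolynomial (Fin (N + 1)) k, f.IsHomogeneous t →
      (∀ i, VanishesTo q ((ρ₀ : A →+* k) ∘ z i) f) →
      f ∈ Submodule.span k (Set.range fun u => map (ρ₀ : A →+* k) (b u))) :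
    ∃ g : A, ρ₀ g ≠ 0 ∧ ∀ (L : Type*) [Field L] (ρ : A →+* L), ρ g ≠ 0 →
      ∀ f : MvPolynomial (Fin (N + 1)) L, f.IsHomogeneous t →
      (∀ i, VanishesTo q (ρ ∘ z i) f) →
      f ∈ Submodule.span L (Set.range fun u => map ρ (b u)) := by
  have hDB : vanishingMatrix z q t * coeffMatrix b t = 0 := by
    ext x u
    have h1 := (vanishesTo_iff_vanishingMatrix_mulVec z q (RingHom.id A) (hb u)).mp (hbz u)
    exact congrFun h1 x
  obtain ⟨g, hg, hgL⟩ := exists_exact_neighbourhood ρ₀ (vanishingMatrix z q t) (coeffMatrix b t)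
    hDB (by
      intro v hv
      obtain ⟨f, hf, rfl⟩ := exists_form_of_coeff v
      obtain ⟨c, rfl⟩ := (Submodule.mem_span_range_iff_exists_fun k).mp
        (h f hf ((vanishesTo_iff_vanishingMatrix_mulVec z q (ρ₀ : A →+* k) hf).mpr hv))
      exact ⟨c, coeffMatrix_mulVec b t (ρ₀ : A →+* k) c⟩)
  refine ⟨g, hg, fun L _ ρ hρ f hf hfv => ?_⟩
  obtain ⟨c, hc⟩ := hgL L ρ hρ _ ((vanishesTo_iff_vanishingMatrix_mulVec z q ρ hf).mp hfv)
  rw [coeffMatrix_mulVec] at hc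
  exact (Submodule.mem_span_range_iff_exists_fun L).mpr
    ⟨c, eq_of_coeff_eq (isHomogeneous_sum_smul_map hb ρ c) hf hc⟩

end MovingPoints

/-! ### Powers of the ideal of moving points -/

section CorrectedForms

variable {k A S : Type*} [Field k] [CommRing A] [Algebra k A] [CommRing S] {N n β : ℕ}

/-- The values of the forms `p` at the points `z`. -/
def evalMatrix (z : Fin n → Fin (N + 1) → A) (p : Fin n → MvPolynomial (Fin (N + 1)) k) :
    Matrix (Fin n) (Fin n) A :=
  Matrix.of fun i l => eval (z l) (map (algebraMap k A) (p i))

/-- The form `f`, scaled and corrected by a combination of the forms `p` to vanish at all of the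
points `z`. -/
def correctedForm (z : Fin n → Fin (N + 1) → A) (p : Fin n → MvPolynomial (Fin (N + 1)) k)
    (f : MvPolynomial (Fin (N + 1)) A) : MvPolynomial (Fin (N + 1)) A :=
  C (evalMatrix z p).det * f - ∑ i,
    C (∑ j, eval (z j) f * (evalMatrix z p).adjugate j i) * map (algebraMap k A) (p i)

/-- Cramer's rule: the adjugate solves the interpolation problem without division, so the corrected
form has coefficients in `A`. -/
theorem eval_correctedForm (z : Fin n → Fin (N + 1) → A)
    (p : Fin n → MvPolynomial (Fin (N + 1)) k) (f : MvPolynomial (Fin (N + 1)) A) (l : Fin n) :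
    eval (z l) (correctedForm z p f) = 0 := by
  have h1 : ∀ j, ∑ i, (evalMatrix z p).adjugate j i * evalMatrix z p i l =
      if j = l then (evalMatrix z p).det else 0 := by
    intro j
    have := congrFun (congrFun (Matrix.adjugate_mul (evalMatrix z p)) j) l
    rw [Matrix.mul_apply, Matrix.smul_apply, Matrix.one_apply, smul_eq_mul, mul_ite, mul_one,
      mul_zero] at this
    exact this
  have h2 : ∑ i, (∑ j, eval (z j) f * (evalMatrix z p).adjugate j i) * evalMatrix z p i l =
      (evalMatrix z p).det * eval (z l) f := by
    simp only [Finset.sum_mul, mul_assoc]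
    rw [Finset.sum_comm]
    simp only [← Finset.mul_sum, h1, mul_ite, mul_zero]
    rw [Finset.sum_ite_eq' Finset.univ l, if_pos (Finset.mem_univ l), mul_comm]
  rw [correctedForm, map_sub, map_mul, eval_C, map_sum, ← h2, sub_eq_zero]
  refine Finset.sum_congr rfl fun i _ => ?_
  rw [map_mul, eval_C]
  rfl

theorem isHomogeneous_correctedForm (z : Fin n → Fin (N + 1) → A)
    {p : Fin n → MvPolynomial (Fin (N + 1)) k} (hp : ∀ i, (p i).IsHomogeneous β)
    {f : MvPolynomial (Fin (N + 1)) A} (hf : f.IsHomogeneous β) :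
    (correctedForm z p f).IsHomogeneous β :=
  (hf.C_mul _).sub (IsHomogeneous.sum _ _ _ fun i _ => ((hp i).map _).C_mul _)

theorem evalMatrix_map (ρ : A →+* S) (z : Fin n → Fin (N + 1) → A)
    (p : Fin n → MvPolynomial (Fin (N + 1)) k) (i l : Fin n) :
    ρ (evalMatrix z p i l) = eval (ρ ∘ z l) (map (ρ.comp (algebraMap k A)) (p i)) := by
  rw [evalMatrix, Matrix.of_apply, ← eval₂_id, eval₂_comp_left, ← map_map, eval₂_eq_eval_map]
  rfl

theorem evalMatrix_map_eq_one (ρ₀ : A →ₐ[k] k) {z : Fin n → Fin (N + 1) → A}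
    {p : Fin n → MvPolynomial (Fin (N + 1)) k}
    (hp : ∀ i l, eval ((ρ₀ : A →+* k) ∘ z l) (p i) = if i = l then 1 else 0) :
    (evalMatrix z p).map ρ₀ = 1 := by
  ext i l
  have h1 : ((ρ₀ : A →+* k).comp (algebraMap k A)) = RingHom.id k := RingHom.ext fun x => by simp
  have h2 := evalMatrix_map (ρ₀ : A →+* k) z p i l
  rw [h1, map_id, hp] at h2
  rw [Matrix.map_apply, Matrix.one_apply]
  exact h2

theorem map_correctedForm (ρ₀ : A →ₐ[k] k) {z : Fin n → Fin (N + 1) → A}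
    {p : Fin n → MvPolynomial (Fin (N + 1)) k}
    (hp : ∀ i l, eval ((ρ₀ : A →+* k) ∘ z l) (p i) = if i = l then 1 else 0)
    (f : MvPolynomial (Fin (N + 1)) k) :
    map (ρ₀ : A →+* k) (correctedForm z p (map (algebraMap k A) f)) =
      f - ∑ i, C (eval ((ρ₀ : A →+* k) ∘ z i) f) * p i := by
  have hE := evalMatrix_map_eq_one ρ₀ hp
  have h1 : ((ρ₀ : A →+* k).comp (algebraMap k A)) = RingHom.id k := RingHom.ext fun x => by simp
  have hdet : (ρ₀ : A →+* k) (evalMatrix z p).det = 1 := by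
    rw [RingHom.map_det, RingHom.mapMatrix_apply]
    exact (congrArg Matrix.det hE).trans Matrix.det_one
  have hadj : ∀ j i, (ρ₀ : A →+* k) ((evalMatrix z p).adjugate j i) = if j = i then 1 else 0 := by
    intro j i
    have h2 := RingHom.map_adjugate (ρ₀ : A →+* k) (evalMatrix z p)
    have h3 : (ρ₀ : A →+* k).mapMatrix (evalMatrix z p) = 1 := hE
    rw [h3, Matrix.adjugate_one] at h2
    exact (congrFun (congrFun h2 j) i).trans Matrix.one_apply
  have heval : ∀ j, (ρ₀ : A →+* k) (eval (z j) (map (algebraMap k A) f)) =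
      eval ((ρ₀ : A →+* k) ∘ z j) f := by
    intro j
    rw [← eval₂_id, eval₂_comp_left, eval₂_eq_eval_map, RingHom.comp_id, map_map, h1, map_id]
  rw [correctedForm, map_sub, map_mul, map_C, hdet, C_1, one_mul, map_map, h1, map_id, map_sum]
  congr 1
  refine Finset.sum_congr rfl fun i _ => ?_
  rw [map_mul, map_C, map_map, h1, map_id, map_sum]
  congr 2
  simp only [map_mul, hadj, heval, mul_ite, mul_one, mul_zero]
  rw [Finset.sum_ite_eq' Finset.univ i, if_pos (Finset.mem_univ i)]

end CorrectedForms

/-! ### Spreading out membership in powers of the ideal of degree-`β` forms -/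

section Powers

/-- The ideal generated by the forms of degree `β` vanishing at the points `w`. -/
def formsIdeal {K : Type*} [Field K] {N n : ℕ} (w : Fin n → Fin (N + 1) → K) (β : ℕ) :
    Ideal (HCoordRing K N) :=
  Ideal.span {g | g.IsHomogeneous β ∧ ∀ i, eval (w i) g = 0}

theorem span_range_pow_le {R ν : Type*} [CommRing R] (G : ν → R) (m : ℕ) :
    Ideal.span (Set.range G) ^ m ≤ Ideal.span (Set.range fun u : Fin m → ν => ∏ j, G (u j)) := by
  induction m with
  | zero =>
    rw [pow_zero, Ideal.one_eq_top, top_le_iff, Ideal.eq_top_iff_one]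
    exact Ideal.subset_span ⟨Fin.elim0, by simp⟩
  | succ m ih =>
    rw [pow_succ]
    refine (Ideal.mul_mono_left ih).trans ?_
    rw [Ideal.span_mul_span']
    refine Ideal.span_mono ?_
    rintro _ ⟨_, ⟨u, rfl⟩, _, ⟨a, rfl⟩, rfl⟩
    exact ⟨Fin.snoc u a, by simp [Fin.prod_univ_castSucc]⟩

theorem mem_span_range_mul_monomial {K μ : Type*} [Field K] {N d t : ℕ} {b : μ → HCoordRing K N}
    (hb : ∀ u, (b u).IsHomogeneous d) {f : HCoordRing K N} (hf : f.IsHomogeneous t)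
    (hmem : f ∈ Ideal.span (Set.range b)) :
    f ∈ Submodule.span K
      (Set.range fun x : μ × FormExponent N (t - d) => b x.1 * monomial x.2.1 1) := by
  refine mem_of_mem_span_of_isHomogeneous (by rintro _ ⟨u, rfl⟩; exact ⟨d, hb u⟩) hf hmem
    (Submodule.span K (Set.range fun x : μ × FormExponent N (t - d) =>
      b x.1 * monomial x.2.1 1)).toAddSubmonoid ?_
  rintro _ ⟨u, rfl⟩ d' e h hd he hde
  by_cases h0 : b u = 0
  · rw [h0, mul_zero]
    exact zero_mem _
  obtain rfl := (hb u).inj_right hd h0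
  obtain rfl : e = t - d := by omega
  rw [eq_sum_formExponent he, Finset.sum_mul]
  refine sum_mem fun a _ => ?_
  have : C (coeff a.1 h) * monomial a.1 1 * b u =
      coeff a.1 h • (b u * monomial a.1 1) := by
    rw [smul_eq_C_mul]
    ring
  rw [this]
  exact Submodule.smul_mem _ _ (Submodule.subset_span ⟨(u, a), rfl⟩)

/-- Products of `m` corrected forms with a monomial of degree `t - m * β` vanish to order `m`
identically over `A`, and at the base point they span the degree `t` part of the `m`-th power.
Spreading out this spanning property also displays the power of `M`. -/
theorem exists_formsIdeal_pow_neighbourhood {k A : Type*} [Field k] [CommRing A] [Algebra k A]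
    {N n β m t : ℕ} (ρ₀ : A →ₐ[k] k) (z : Fin n → Fin (N + 1) → A)
    {p : Fin n → HCoordRing k N} (hpβ : ∀ i, (p i).IsHomogeneous β)
    (hp : ∀ i l, eval ((ρ₀ : A →+* k) ∘ z l) (p i) = if i = l then 1 else 0)
    (ht : m * β ≤ t)
    (h : ∀ f : HCoordRing k N, f.IsHomogeneous t →
      (∀ i, VanishesTo m ((ρ₀ : A →+* k) ∘ z i) f) →
      f ∈ formsIdeal (fun i => (ρ₀ : A →+* k) ∘ z i) β ^ m) :
    ∃ g : A, ρ₀ g ≠ 0 ∧ ∀ (L : Type*) [Field L] (ρ : A →+* L), ρ g ≠ 0 →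
      ∀ f : HCoordRing L N, f.IsHomogeneous t → (∀ i, VanishesTo m (ρ ∘ z i) f) →
      f ∈ irrelevantIdeal L N ^ (t - m * β) * formsIdeal (fun i => ρ ∘ z i) β ^ m := by
  set G : FormExponent N β → MvPolynomial (Fin (N + 1)) A :=
    fun a => correctedForm z p (monomial a.1 1) with hG
  have hGhom : ∀ a, (G a).IsHomogeneous β := fun a => isHomogeneous_correctedForm z hpβ
    (isHomogeneous_monomial 1 (mem_finsuppAntidiag_univ_iff.mp a.2))
  have hprod : ∀ u : Fin m → FormExponent N β, (∏ j, G (u j)).IsHomogeneous (m * β) := by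
    intro u
    simpa using IsHomogeneous.prod Finset.univ (fun j => G (u j)) (fun _ => β) fun j _ => hGhom _
  set b : (Fin m → FormExponent N β) × FormExponent N (t - m * β) →
      MvPolynomial (Fin (N + 1)) A := fun x => (∏ j, G (x.1 j)) * monomial x.2.1 1 with hb
  have hbhom : ∀ x, (b x).IsHomogeneous t := by
    intro x
    have := (hprod x.1).mul
      (isHomogeneous_monomial (1 : A) (mem_finsuppAntidiag_univ_iff.mp x.2.2))
    rwa [Nat.add_sub_cancel' ht] at this
  have hbz : ∀ x i, VanishesTo m (z i) (b x) := by
    intro x i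
    rw [hb]
    dsimp only
    rw [mul_comm]
    refine VanishesTo.mul_left ?_ _
    simpa using VanishesTo.prod Finset.univ (q := fun _ => 1) (fun j _ =>
      vanishesTo_one_iff.mpr (eval_correctedForm z p (monomial (x.1 j).1 1) i))
  obtain ⟨g, hg, hgL⟩ := exists_mem_span_neighbourhood ρ₀ z b hbhom hbz (by
    intro f hf hfv
    have hle : formsIdeal (fun i => (ρ₀ : A →+* k) ∘ z i) β ≤
        Ideal.span (Set.range fun a => map (ρ₀ : A →+* k) (G a)) := by
      refine Ideal.span_le.mpr ?_
      rintro f' ⟨hf', hv'⟩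
      have h1 : f' = ∑ a : FormExponent N β, C (coeff a.1 f') * map (ρ₀ : A →+* k) (G a) := by
        have h2 : ∀ a : FormExponent N β, map (ρ₀ : A →+* k) (G a) =
            monomial a.1 1 - ∑ i, C (eval ((ρ₀ : A →+* k) ∘ z i) (monomial a.1 1)) * p i := by
          intro a
          rw [← map_correctedForm ρ₀ hp, hG]
          simp
        simp only [h2, mul_sub, Finset.sum_sub_distrib]
        rw [← eq_sum_formExponent hf']
        -- The corrections of the individual monomials add up to the interpolant of `f'`, which is
        -- zero because `f'` vanishes at the points.
        have h3 : ∑ a : FormExponent N β, C (coeff a.1 f') *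
            ∑ i, C (eval ((ρ₀ : A →+* k) ∘ z i) (monomial a.1 1)) * p i = 0 := by
          simp only [Finset.mul_sum, ← mul_assoc, ← C_mul]
          rw [Finset.sum_comm]
          refine Finset.sum_eq_zero fun i _ => ?_
          rw [← Finset.sum_mul, ← map_sum]
          have h4 := hv' i
          rw [eq_sum_formExponent hf', map_sum] at h4
          simp only [map_mul, eval_C] at h4
          rw [h4, C_0, zero_mul]
        rw [h3, sub_zero]
      rw [h1]
      exact sum_mem fun a _ => Ideal.mul_mem_left _ _ (Ideal.subset_span ⟨a, rfl⟩)
    have h5 := span_range_pow_le _ _ (Ideal.pow_right_mono hle m (h f hf hfv))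
    have h6 := mem_span_range_mul_monomial (d := m * β) (fun u => by
      simpa using (hprod u).map (ρ₀ : A →+* k)) hf h5
    simpa [hb] using h6)
  refine ⟨g, hg, fun L _ ρ hρ f hf hfv => ?_⟩
  have hle : Submodule.span L (Set.range fun u => map ρ (b u)) ≤
      (irrelevantIdeal L N ^ (t - m * β) *
        formsIdeal (fun i => ρ ∘ z i) β ^ m).restrictScalars L := by
    refine Submodule.span_le.mpr ?_
    rintro _ ⟨⟨u, c⟩, rfl⟩
    rw [hb]
    dsimp only
    rw [map_mul, map_prod, map_monomial, map_one, mul_comm (∏ j, map ρ (G (u j)))]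
    refine Ideal.mul_mem_mul (mem_irrelevantIdeal_pow
      (isHomogeneous_monomial (1 : L) (mem_finsuppAntidiag_univ_iff.mp c.2))) ?_
    have := Ideal.prod_mem_prod (s := Finset.univ)
      (I := fun _ : Fin m => formsIdeal (fun i => ρ ∘ z i) β) (x := fun j => map ρ (G (u j)))
      fun j _ => Ideal.subset_span ⟨(hGhom (u j)).map ρ, fun i => vanishesTo_one_iff.mp
        ((vanishesTo_one_iff.mpr (eval_correctedForm z p (monomial (u j).1 1) i)).map ρ)⟩
    simpa using this
  exact hle (hgL L ρ hρ f hf hfv)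

end Powers

/-! ### Configurations near a star configuration -/

section StarNeighbourhood

/-- The star configuration on the moment curve. -/
theorem isStar_moment (K : Type*) [Field K] [CharZero K] (N : ℕ) (s : Finset ℕ) :
    IsStar (N := N) s (fun i j => (i : K) ^ (j : ℕ))
      (fun A j => (∏ a ∈ A, (Polynomial.X - Polynomial.C (a : K))).coeff j) := by
  have hdeg : ∀ A : Finset ℕ,
      (∏ a ∈ A, (Polynomial.X - Polynomial.C (a : K))).natDegree = A.card := fun A => by
    rw [Polynomial.natDegree_prod_of_monic _ _ fun a _ => Polynomial.monic_X_sub_C _]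
    simp only [Polynomial.natDegree_X_sub_C, Finset.sum_const, smul_eq_mul, mul_one]
  have hmonic : ∀ A : Finset ℕ, (∏ a ∈ A, (Polynomial.X - Polynomial.C (a : K))).Monic := fun A =>
    Polynomial.monic_prod_of_monic _ _ fun a _ => Polynomial.monic_X_sub_C _
  constructor
  · intro A _ hc h0
    have h1 := congrFun h0 ⟨A.card, by omega⟩
    have h2 := (hmonic A).coeff_natDegree
    rw [hdeg] at h2
    rw [Pi.zero_apply] at h1
    exact one_ne_zero (h2.symm.trans h1)
  · intro A _ hc i _
    -- Pairing powers of `i` with coefficients evaluates the polynomial whose roots are the elements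
    -- of `A`; in characteristic zero, distinct naturals are distinct roots.
    have h1 : (fun j : Fin (N + 1) => (i : K) ^ (j : ℕ)) ⬝ᵥ
        (fun j => (∏ a ∈ A, (Polynomial.X - Polynomial.C (a : K))).coeff j) =
        (∏ a ∈ A, (Polynomial.X - Polynomial.C (a : K))).eval (i : K) := by
      rw [Polynomial.eval_eq_sum_range' (n := N + 1) (by rw [hdeg]; omega), dotProduct,
        Finset.sum_range]
      exact Finset.sum_congr rfl fun j _ => mul_comm _ _
    rw [h1, Polynomial.eval_prod, Finset.prod_eq_zero_iff]
    constructor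
    · rintro ⟨a, ha, h2⟩
      rw [Polynomial.eval_sub, Polynomial.eval_X, Polynomial.eval_C, sub_eq_zero,
        Nat.cast_inj] at h2
      exact h2 ▸ ha
    · exact fun hi => ⟨i, hi, by simp⟩

variable {k ι : Type*} [Field k] [DecidableEq ι] {N n β : ℕ} {s : Finset ι}
  {ℓ : ι → Fin (N + 1) → k} {P : Finset ι → Fin (N + 1) → k} {A : Fin n → Finset ι}

/-- The product of the `β - 1` forms outside `A i` vanishes at every other star point but not at its
own. A coordinate nonzero there raises the degree to `β`. -/
theorem IsStar.exists_dual_forms (h : IsStar s ℓ P) (hs : s.card + 1 = β + N) (hβ : 1 ≤ β)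
    (hAs : ∀ i, A i ⊆ s) (hAc : ∀ i, (A i).card = N) (hA : Function.Injective A) :
    ∃ p : Fin n → HCoordRing k N, (∀ i, (p i).IsHomogeneous β) ∧
      ∀ i l, eval (P (A l)) (p i) = if i = l then 1 else 0 := by
  have hex : ∀ i, ∃ f : HCoordRing k N, f.IsHomogeneous β ∧
      ∀ l, eval (P (A l)) f = if i = l then 1 else 0 := by
    intro i
    obtain ⟨j, hj⟩ := Function.ne_iff.mp (h.ne_zero (A i) (hAs i) (hAc i).le)
    set f : HCoordRing k N := X j * ∏ a ∈ s \ A i, linForm (ℓ a) with hf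
    have hhom : f.IsHomogeneous β := by
      have h1 : (∏ a ∈ s \ A i, linForm (ℓ a)).IsHomogeneous (s \ A i).card := by
        simpa using IsHomogeneous.prod (s \ A i) (fun a => linForm (ℓ a)) (fun _ => 1)
          fun a _ => linForm_isHomogeneous (ℓ a)
      have h2 := (isHomogeneous_X k j).mul h1
      rw [Finset.card_sdiff_of_subset (hAs i), hAc] at h2
      rwa [show 1 + (s.card - N) = β by omega] at h2
    have hval : eval (P (A i)) f ≠ 0 := by
      rw [hf, map_mul, eval_X, map_prod]
      refine mul_ne_zero hj (Finset.prod_ne_zero_iff.mpr fun a ha => ?_)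
      rw [Finset.mem_sdiff] at ha
      rw [eval_linForm]
      exact fun h0 => ha.2 ((h.dotProduct_eq_zero_iff _ (hAs i) (hAc i).le a ha.1).mp h0)
    refine ⟨C (eval (P (A i)) f)⁻¹ * f, hhom.C_mul _, fun l => ?_⟩
    rw [map_mul, eval_C]
    split_ifs with hil
    · subst hil
      exact inv_mul_cancel₀ hval
    · have hne : ¬ A l ⊆ A i := fun hsub =>
        hil (hA (Finset.eq_of_subset_of_card_le hsub (by rw [hAc, hAc])).symm)
      obtain ⟨a, hal, hai⟩ := Finset.not_subset.mp hne
      have h0 : eval (P (A l)) f = 0 := by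
        rw [hf, map_mul, map_prod, Finset.prod_eq_zero (i := a)
          (Finset.mem_sdiff.mpr ⟨hAs l hal, hai⟩), mul_zero]
        rw [eval_linForm]
        exact (h.dotProduct_eq_zero_iff _ (hAs l) (hAc l).le a (hAs l hal)).mpr hal
      rw [h0, mul_zero]
  choose p hp1 hp2 using hex
  exact ⟨p, hp1, hp2⟩

/-- The vectors of variables, coordinates of the generic configuration. -/
def varVec (k : Type*) [Field k] (N n : ℕ) (i : Fin n) :
    Fin (N + 1) → MvPolynomial (Fin n × Fin (N + 1)) k :=
  fun j => X (i, j)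

theorem aeval_comp_varVec {L : Type*} [Field L] [Algebra k L] (w : Fin n → Fin (N + 1) → L)
    (i : Fin n) :
    ((aeval fun ij : Fin n × Fin (N + 1) => w ij.1 ij.2 :
      MvPolynomial (Fin n × Fin (N + 1)) k →ₐ[k] L) : _ →+* L) ∘ varVec k N n i = w i := by
  funext j
  simp [varVec]

theorem formsIdeal_le_definingIdeal {L : Type*} [Field L] {w : Fin n → Fin (N + 1) → L}
    (hw : ∀ i, w i ≠ 0) (β : ℕ) :
    formsIdeal w β ≤
      definingIdeal (Set.range fun i => Projectivization.mk L (w i) (hw i)) := by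
  refine Ideal.span_le.mpr ?_
  rintro g ⟨hg, hv⟩
  refine (Ideal.mem_iInf.mpr fun p => Ideal.mem_iInf.mpr ?_)
  rintro ⟨i, rfl⟩
  exact mem_pointIdeal_mk (hw i) hg (hv i)

/-- Below degree `m * s.card` the star configuration admits no nonzero forms, and this spreads out.
From that degree on, membership in the `m`-th power spreads out, and the excess degree supplies the
factor of `M`. -/
theorem IsStar.exists_formContainment (h : IsStar s ℓ P) (hs : s.card + 1 = β + N) (hN : 1 ≤ N)
    (hβ : 1 ≤ β) (hAs : ∀ i, A i ⊆ s) (hAc : ∀ i, (A i).card = N) (hA : Function.Injective A)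
    (hsurj : ∀ B ⊆ s, B.card = N → ∃ i, A i = B) (m t : ℕ) :
    ∃ g : MvPolynomial (Fin n × Fin (N + 1)) k,
      eval (fun ij : Fin n × Fin (N + 1) => P (A ij.1) ij.2) g ≠ 0 ∧
      ∀ (L : Type*) [Field L] [Algebra k L] (w : Fin n → Fin (N + 1) → L) (hw : ∀ i, w i ≠ 0),
        aeval (fun ij : Fin n × Fin (N + 1) => w ij.1 ij.2) g ≠ 0 →
        FormContainment m t (Set.range fun i => Projectivization.mk L (w i) (hw i)) := by
  set ρ₀ : MvPolynomial (Fin n × Fin (N + 1)) k →ₐ[k] k :=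
    aeval fun ij : Fin n × Fin (N + 1) => P (A ij.1) ij.2 with hρ₀
  have hz₀ : ∀ i, (ρ₀ : _ →+* k) ∘ varVec k N n i = P (A i) := fun i =>
    aeval_comp_varVec (fun i => P (A i)) i
  have hall : ∀ {q : ℕ} {f : HCoordRing k N},
      (∀ i, VanishesTo q ((ρ₀ : _ →+* k) ∘ varVec k N n i) f) →
      ∀ B ⊆ s, B.card = N → VanishesTo q (P B) f := by
    intro q f hf B hB hBc
    obtain ⟨i, rfl⟩ := hsurj B hB hBc
    rw [← hz₀]
    exact hf i
  by_cases ht : t < m * s.card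
  -- With an empty family of generators, membership in the span means being zero.
  · obtain ⟨g, hg, hgL⟩ := exists_mem_span_neighbourhood (μ := Empty) (q := N * m) (t := t) ρ₀
      (varVec k N n) (fun u => u.elim) (fun u => u.elim) (fun u => u.elim) (fun f hf hfv => by
        rw [h.eq_zero_of_vanishesTo hN (by omega) ht hf (hall hfv)]
        exact zero_mem _)
    refine ⟨g, hg, fun L _ _ w hw hgw f hf hfv => ?_⟩
    have := hgL L (aeval fun ij : Fin n × Fin (N + 1) => w ij.1 ij.2 :
      MvPolynomial (Fin n × Fin (N + 1)) k →ₐ[k] L) hgw f hf (fun i => by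
        rw [aeval_comp_varVec]
        exact VanishesTo.rep_mk (hw i) hf (hfv _ ⟨i, rfl⟩))
    rw [Set.range_eq_empty, Submodule.span_empty, Submodule.mem_bot] at this
    rw [this]
    exact zero_mem _
  · obtain ⟨p, hp, hpv⟩ := h.exists_dual_forms hs hβ hAs hAc hA
    push Not at ht
    have hms : m * s.card = m * β + m * (N - 1) := by
      rw [← mul_add]
      congr 1
      omega
    obtain ⟨g, hg, hgL⟩ := exists_formsIdeal_pow_neighbourhood (m := m) (t := t) ρ₀ (varVec k N n)
      hp (fun i l => by rw [hz₀, hpv]) (by omega) (fun f hf hfv => by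
        refine Ideal.pow_right_mono (Ideal.span_mono ?_) m
          (h.mem_span_starProducts_pow hs hβ (by omega) hf (hall hfv))
        rintro _ ⟨T, hT, hTc, rfl⟩
        constructor
        · have := IsHomogeneous.prod T (fun a => linForm (ℓ a)) (fun _ => 1)
            fun a _ => linForm_isHomogeneous (ℓ a)
          simpa [hTc] using this
        · intro i
          -- Sets of `β` and of `N` elements among `β + N - 1` must meet.
          obtain ⟨a, ha⟩ : ∃ a, a ∈ T ∩ A i := by
            by_contra! hempty
            have h1 := Finset.card_union_of_disjoint (Finset.disjoint_iff_inter_eq_empty.mpr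
              (Finset.eq_empty_of_forall_notMem hempty))
            have h2 := Finset.card_le_card (Finset.union_subset hT (hAs i))
            rw [h1, hTc, hAc] at h2
            omega
          rw [Finset.mem_inter] at ha
          dsimp only
          rw [hz₀, map_prod]
          refine Finset.prod_eq_zero ha.1 ?_
          rw [eval_linForm]
          exact (h.dotProduct_eq_zero_iff _ (hAs i) (hAc i).le a (hT ha.1)).mpr ha.2)
    refine ⟨g, hg, fun L _ _ w hw hgw f hf hfv => ?_⟩
    have := hgL L (aeval fun ij : Fin n × Fin (N + 1) => w ij.1 ij.2 :
      MvPolynomial (Fin n × Fin (N + 1)) k →ₐ[k] L) hgw f hf (fun i => by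
        rw [aeval_comp_varVec]
        exact VanishesTo.mono (VanishesTo.rep_mk (hw i) hf (hfv _ ⟨i, rfl⟩))
          (Nat.le_mul_of_pos_left m hN))
    simp only [aeval_comp_varVec] at this
    exact Ideal.mul_mono (Ideal.pow_le_pow_right (by omega))
      (Ideal.pow_right_mono (formsIdeal_le_definingIdeal hw β) m) this

/-- The values of the dual forms make an identity matrix at the star configuration, whereas two
equal points make two columns proportional, with factor `c ^ β`. -/
theorem IsStar.exists_injective (h : IsStar s ℓ P) (hs : s.card + 1 = β + N)
    (hβ : 1 ≤ β) (hAs : ∀ i, A i ⊆ s) (hAc : ∀ i, (A i).card = N) (hA : Function.Injective A) :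
    ∃ g : MvPolynomial (Fin n × Fin (N + 1)) k,
      eval (fun ij : Fin n × Fin (N + 1) => P (A ij.1) ij.2) g ≠ 0 ∧
      ∀ (w : Fin n → Fin (N + 1) → k) (hw : ∀ i, w i ≠ 0),
        eval (fun ij : Fin n × Fin (N + 1) => w ij.1 ij.2) g ≠ 0 →
        Function.Injective fun i => Projectivization.mk k (w i) (hw i) := by
  obtain ⟨p, hp, hpv⟩ := h.exists_dual_forms hs hβ hAs hAc hA
  refine ⟨(evalMatrix (varVec k N n) p).det, ?_, ?_⟩
  · have h1 := evalMatrix_map_eq_one (aeval fun ij : Fin n × Fin (N + 1) => P (A ij.1) ij.2)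
      (z := varVec k N n) (p := p) (fun i l => by
        rw [aeval_comp_varVec (fun i => P (A i)), hpv])
    rw [RingHom.map_det, RingHom.mapMatrix_apply]
    have h2 : (evalMatrix (varVec k N n) p).map
        (eval fun ij : Fin n × Fin (N + 1) => P (A ij.1) ij.2) = 1 := h1
    rw [h2, Matrix.det_one]
    exact one_ne_zero
  · intro w hw hdet i l hil
    by_contra hne
    refine hdet ?_
    rw [RingHom.map_det, RingHom.mapMatrix_apply]
    obtain ⟨c, hc⟩ := (Projectivization.mk_eq_mk_iff' k _ _ (hw i) (hw l)).mp hil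
    have hentry : ∀ a b, (evalMatrix (varVec k N n) p).map
        (eval fun ij : Fin n × Fin (N + 1) => w ij.1 ij.2) a b = eval (w b) (p a) := by
      intro a b
      rw [Matrix.map_apply, evalMatrix_map]
      have h1 : ((eval fun ij : Fin n × Fin (N + 1) => w ij.1 ij.2).comp
          (algebraMap k (MvPolynomial (Fin n × Fin (N + 1)) k))) = RingHom.id k :=
        RingHom.ext fun x => by simp [MvPolynomial.algebraMap_eq]
      rw [h1, map_id]
      congr 2
      exact aeval_comp_varVec w b
    refine Matrix.exists_mulVec_eq_zero_iff.mp ⟨Pi.single i 1 - c ^ β • Pi.single l 1, ?_, ?_⟩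
    · intro h0
      have := congrFun h0 i
      simp [hne] at this
    · funext a
      rw [Matrix.mulVec_sub, Matrix.mulVec_smul]
      simp only [Matrix.mulVec_single_one, Pi.sub_apply, Pi.smul_apply, Matrix.col_apply, hentry,
        smul_eq_mul, Pi.zero_apply]
      have := aeval_smul_X_of_isHomogeneous (hp a) c (w l)
      rw [sub_eq_zero, ← hc]
      exact this

end StarNeighbourhood

/-! ### Open sets of the Chow variety -/

section Multihomogeneous

variable {k : Type*} [Field k] {N n : ℕ}

theorem aeval_mul_of_isWeightedHomogeneous {B : Type*} [CommRing B] [Algebra k B]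
    {F : MvPolynomial (Fin n × Fin (N + 1)) k} {d : Fin n → ℕ}
    (hF : IsWeightedHomogeneous
      (fun ij : Fin n × Fin (N + 1) => (Pi.single ij.1 1 : Fin n → ℕ)) F d)
    (c : Fin n → B) (v : Fin n × Fin (N + 1) → B) :
    aeval (fun ij => c ij.1 * v ij) F = (∏ i, c i ^ d i) * aeval v F := by
  rw [aeval_def, aeval_def, eval₂_eq', eval₂_eq', Finset.mul_sum]
  refine Finset.sum_congr rfl fun e he => ?_
  have hd : ∀ i, d i = ∑ j, e (i, j) := by
    intro i
    rw [← hF (mem_support_iff.mp he), Finsupp.weight_apply, Finsupp.sum_fintype _ _ (by simp),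
      Finset.sum_apply, Fintype.sum_prod_type, Finset.sum_eq_single i]
    · simp
    · intro b _ hb
      simp [hb.symm]
    · simp
  have hc : ∏ ij : Fin n × Fin (N + 1), c ij.1 ^ e ij = ∏ i, c i ^ d i := by
    rw [Fintype.prod_prod_type]
    refine Finset.prod_congr rfl fun i _ => ?_
    rw [hd, ← Finset.prod_pow_eq_pow_sum]
  simp only [mul_pow, Finset.prod_mul_distrib]
  rw [hc]
  ring

theorem eval_smul_ne_zero_iff {F : MvPolynomial (Fin n × Fin (N + 1)) k} {d : Fin n → ℕ}
    (hF : IsWeightedHomogeneous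
      (fun ij : Fin n × Fin (N + 1) => (Pi.single ij.1 1 : Fin n → ℕ)) F d)
    {c : Fin n → k} (hc : ∀ i, c i ≠ 0) (v : Fin n × Fin (N + 1) → k) :
    eval (fun ij => c ij.1 * v ij) F ≠ 0 ↔ eval v F ≠ 0 := by
  have h : eval (fun ij => c ij.1 * v ij) F = (∏ i, c i ^ d i) * eval v F :=
    aeval_mul_of_isWeightedHomogeneous hF c v
  rw [h, mul_ne_zero_iff, and_iff_right]
  exact Finset.prod_ne_zero_iff.mpr fun i _ => pow_ne_zero _ (hc i)

theorem exists_eval_ne_zero [Infinite k] {τ : Type*} {F : MvPolynomial τ k} (hF : F ≠ 0) :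
    ∃ v, eval v F ≠ 0 := by
  by_contra! h
  exact hF (MvPolynomial.funext fun v => by rw [h, map_zero])

/-- Basic open sets need multihomogeneous equations, so take a component of `g` that is nonzero at
`v₀`. Where it is nonzero, rescaling the points independently gives a nonzero polynomial in the
scalars, so suitable representatives satisfy `g ≠ 0`. -/
theorem exists_isWeightedHomogeneous_of_eval_ne_zero [Infinite k]
    {g : MvPolynomial (Fin n × Fin (N + 1)) k} {v₀ : Fin n × Fin (N + 1) → k}
    (hg : eval v₀ g ≠ 0) :
    ∃ (F : MvPolynomial (Fin n × Fin (N + 1)) k) (d : Fin n → ℕ), IsWeightedHomogeneous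
        (fun ij : Fin n × Fin (N + 1) => (Pi.single ij.1 1 : Fin n → ℕ)) F d ∧
      eval v₀ F ≠ 0 ∧ ∀ v, eval v F ≠ 0 →
        ∃ c : Fin n → k, (∀ i, c i ≠ 0) ∧ eval (fun ij => c ij.1 * v ij) g ≠ 0 := by
  set wt := fun ij : Fin n × Fin (N + 1) => (Pi.single ij.1 1 : Fin n → ℕ) with hwt
  have hsum := finsum_weightedHomogeneousComponent wt g
  rw [finsum_eq_sum _ (weightedHomogeneousComponent_finsupp g)] at hsum
  set T := (weightedHomogeneousComponent_finsupp (w := wt) g).toFinset with hT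
  obtain ⟨d, hdT, hd⟩ : ∃ d ∈ T, eval v₀ (weightedHomogeneousComponent wt d g) ≠ 0 := by
    by_contra! h
    rw [← hsum, map_sum] at hg
    exact hg (Finset.sum_eq_zero h)
  refine ⟨_, d, weightedHomogeneousComponent_isWeightedHomogeneous d g, hd, fun v hv => ?_⟩
  set H : MvPolynomial (Fin n) k := aeval (fun ij => X ij.1 * C (v ij)) g with hH
  have hHsum : H = ∑ e ∈ T, monomial (Finsupp.equivFunOnFinite.symm e)
      (eval v (weightedHomogeneousComponent wt e g)) := by
    rw [hH]
    conv_lhs => rw [← hsum]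
    rw [map_sum]
    refine Finset.sum_congr rfl fun e _ => ?_
    rw [aeval_mul_of_isWeightedHomogeneous
      (weightedHomogeneousComponent_isWeightedHomogeneous e g) X (fun ij => C (v ij)),
      monomial_eq, mul_comm, Finsupp.prod_fintype _ _ (by simp)]
    congr 1
    have h1 := DFunLike.congr_fun (comp_aeval v (Algebra.ofId k (MvPolynomial (Fin n) k)))
      (weightedHomogeneousComponent wt e g)
    exact h1.symm
  have hH0 : H ≠ 0 := by
    intro h0
    have := congrArg (coeff (Finsupp.equivFunOnFinite.symm d)) hHsum
    rw [h0, coeff_zero, coeff_sum, Finset.sum_eq_single d, coeff_monomial, if_pos rfl] at this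
    · exact hv this.symm
    · intro e _ he
      rw [coeff_monomial, if_neg fun h => he (Finsupp.equivFunOnFinite.symm.injective h)]
    · exact fun h => absurd hdT h
  -- The extra product of variables keeps all the scalars nonzero.
  obtain ⟨c, hc⟩ := exists_eval_ne_zero (F := H * ∏ i, X i)
    (mul_ne_zero hH0 (Finset.prod_ne_zero_iff.mpr fun i _ => X_ne_zero i))
  rw [map_mul, mul_ne_zero_iff, map_prod, Finset.prod_ne_zero_iff] at hc
  refine ⟨c, fun i => by simpa using hc.2 i (Finset.mem_univ i), ?_⟩
  have h2 : eval c H = eval (fun ij => c ij.1 * v ij) g := by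
    have h1 := DFunLike.congr_fun (comp_aeval (R := k)
      (fun ij : Fin n × Fin (N + 1) => (X ij.1 * C (v ij) : MvPolynomial (Fin n) k)) (aeval c)) g
    have h3 : (fun ij : Fin n × Fin (N + 1) =>
        aeval c (X ij.1 * C (v ij) : MvPolynomial (Fin n) k)) = fun ij => c ij.1 * v ij := by
      funext ij
      simp
    rw [h3] at h1
    exact h1
  rw [← h2]
  exact hc.1

end Multihomogeneous

/-! ### Tuples of points, cycles and the quotient topology -/

section Chow

variable {k : Type*} [Field k] {N n : ℕ}

/-- The coordinates of the chosen representatives of a tuple of points. -/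
def repCoord (x : Fin n → PPoint k N) (ij : Fin n × Fin (N + 1)) : k := (x ij.1).rep ij.2

theorem exists_repCoord_mk {v : Fin n → Fin (N + 1) → k} (hv : ∀ i, v i ≠ 0) :
    ∃ c : Fin n → k, (∀ i, c i ≠ 0) ∧
      repCoord (fun i => Projectivization.mk k (v i) (hv i)) =
        fun ij => c ij.1 * v ij.1 ij.2 := by
  have := fun i => Projectivization.exists_smul_eq_mk_rep k (v i) (hv i)
  choose c hc using this
  refine ⟨fun i => c i, fun i => (c i).ne_zero, funext fun ij => ?_⟩
  rw [repCoord, ← hc]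
  rfl

/-- Equal multisets have equal multiplicities, so the fibres of `x` and `y` over each point are in
bijection, and these bijections glue. -/
theorem exists_perm_of_cycleOf_eq {x y : Fin n → PPoint k N} (h : cycleOf x = cycleOf y) :
    ∃ σ : Equiv.Perm (Fin n), y ∘ σ = x := by
  classical
  have h1 : Multiset.map x Finset.univ.val = Multiset.map y Finset.univ.val :=
    congrArg Subtype.val h
  have h2 : ∀ p, Nonempty ({a // x a = p} ≃ {a // y a = p}) := by
    intro p
    refine Fintype.card_eq.mp ?_
    rw [Fintype.card_subtype (fun a => x a = p), Fintype.card_subtype (fun a => y a = p)]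
    have := congrArg (Multiset.count p) h1
    rw [Multiset.count_map, Multiset.count_map] at this
    simp only [eq_comm (a := p)] at this
    exact this
  refine ⟨Equiv.ofFiberEquiv fun p => (h2 p).some, funext fun a => ?_⟩
  exact Equiv.ofFiberEquiv_map (fun p => (h2 p).some) a

theorem cycleOf_comp_perm (x : Fin n → PPoint k N) (σ : Equiv.Perm (Fin n)) :
    cycleOf (x ∘ σ) = cycleOf x := by
  refine Subtype.ext ?_
  change Multiset.map (x ∘ σ) Finset.univ.val = Multiset.map x Finset.univ.val
  rw [← Multiset.map_map, Multiset.map_univ_val_equiv]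

theorem cycleOf_surjective : Function.Surjective (cycleOf : (Fin n → PPoint k N) → _) := by
  rintro ⟨s, hs⟩
  induction s using Quotient.inductionOn with
  | h l =>
    subst hs
    refine ⟨fun i => l.get i, Subtype.ext ?_⟩
    change Multiset.map l.get (Finset.univ : Finset (Fin l.length)).val = (l : Multiset (PPoint k N))
    rw [Fin.univ_val_map, List.ofFn_get]

theorem isOpen_eval_ne_zero {F : MvPolynomial (Fin n × Fin (N + 1)) k} {d : Fin n → ℕ}
    (hF : IsWeightedHomogeneous
      (fun ij : Fin n × Fin (N + 1) => (Pi.single ij.1 1 : Fin n → ℕ)) F d) :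
    @IsOpen _ (zariskiProd k N n) {x | eval (repCoord x) F ≠ 0} :=
  TopologicalSpace.isOpen_generateFrom_of_mem ⟨F, d, hF, rfl⟩

theorem isOpen_eval_comp_perm_ne_zero {F : MvPolynomial (Fin n × Fin (N + 1)) k} {d : Fin n → ℕ}
    (hF : IsWeightedHomogeneous
      (fun ij : Fin n × Fin (N + 1) => (Pi.single ij.1 1 : Fin n → ℕ)) F d)
    (σ : Equiv.Perm (Fin n)) :
    @IsOpen _ (zariskiProd k N n) {x | eval (repCoord (x ∘ σ)) F ≠ 0} := by
  have h1 : IsWeightedHomogeneous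
      (fun ij : Fin n × Fin (N + 1) => (Pi.single ij.1 1 : Fin n → ℕ))
      (rename (Prod.map σ id) F) (d ∘ σ.symm) := by
    classical
    intro e he
    obtain ⟨e', rfl, he'⟩ := coeff_rename_ne_zero _ _ _ he
    rw [← hF he', Finsupp.weight_apply, Finsupp.weight_apply,
      Finsupp.sum_mapDomain_index (by simp) (by simp [add_smul])]
    funext i
    rw [Function.comp_apply, Finsupp.sum, Finsupp.sum, Finset.sum_apply, Finset.sum_apply]
    refine Finset.sum_congr rfl fun ij _ => ?_
    simp [Pi.single_apply, Equiv.symm_apply_eq]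
  have h2 : {x : Fin n → PPoint k N | eval (repCoord (x ∘ σ)) F ≠ 0} =
      {x | eval (repCoord x) (rename (Prod.map σ id) F) ≠ 0} := by
    ext x
    rw [Set.mem_ofPred_eq, Set.mem_ofPred_eq, eval_rename]
    rfl
  rw [h2]
  exact isOpen_eval_ne_zero h1

theorem exists_eval_ne_zero_subset {O : Set (Fin n → PPoint k N)}
    (hO : @IsOpen _ (zariskiProd k N n) O) {x : Fin n → PPoint k N} (hx : x ∈ O) :
    ∃ (F : MvPolynomial (Fin n × Fin (N + 1)) k) (d : Fin n → ℕ), IsWeightedHomogeneous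
        (fun ij : Fin n × Fin (N + 1) => (Pi.single ij.1 1 : Fin n → ℕ)) F d ∧
      eval (repCoord x) F ≠ 0 ∧ {y | eval (repCoord y) F ≠ 0} ⊆ O := by
  change TopologicalSpace.GenerateOpen _ O at hO
  induction hO with
  | basic U hU =>
    obtain ⟨F, d, hF, rfl⟩ := hU
    exact ⟨F, d, hF, hx, subset_rfl⟩
  | univ => exact ⟨1, 0, isWeightedHomogeneous_one k _, by simp, Set.subset_univ _⟩
  | inter U V _ _ ihU ihV =>
    obtain ⟨F, d, hF, hxF, hFU⟩ := ihU hx.1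
    obtain ⟨G, e, hG, hxG, hGV⟩ := ihV hx.2
    refine ⟨F * G, d + e, hF.mul hG, ?_, fun y hy => ?_⟩
    · rw [map_mul]
      exact mul_ne_zero hxF hxG
    · rw [Set.mem_ofPred_eq, map_mul, mul_ne_zero_iff] at hy
      exact ⟨hFU hy.1, hGV hy.2⟩
  | sUnion S _ ih =>
    obtain ⟨U, hU, hxU⟩ := hx
    obtain ⟨F, d, hF, hxF, hFU⟩ := ih U hU hxU
    exact ⟨F, d, hF, hxF, fun y hy => ⟨U, hU, hFU hy⟩⟩

/-- This is irreducibility of the product. The factor `∏ X (i, 0)` makes every coordinate vector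
nonzero, so that it defines a point. -/
theorem exists_common_point [Infinite k] {F G : MvPolynomial (Fin n × Fin (N + 1)) k}
    {d e : Fin n → ℕ}
    (hF : IsWeightedHomogeneous
      (fun ij : Fin n × Fin (N + 1) => (Pi.single ij.1 1 : Fin n → ℕ)) F d)
    (hG : IsWeightedHomogeneous
      (fun ij : Fin n × Fin (N + 1) => (Pi.single ij.1 1 : Fin n → ℕ)) G e)
    (hF0 : F ≠ 0) (hG0 : G ≠ 0) :
    ∃ y : Fin n → PPoint k N, eval (repCoord y) F ≠ 0 ∧ eval (repCoord y) G ≠ 0 := by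
  obtain ⟨v, hv⟩ := exists_eval_ne_zero (F := F * G * ∏ i : Fin n, X (i, (0 : Fin (N + 1))))
    (mul_ne_zero (mul_ne_zero hF0 hG0) (Finset.prod_ne_zero_iff.mpr fun i _ => X_ne_zero _))
  rw [map_mul, map_mul, mul_ne_zero_iff, mul_ne_zero_iff, map_prod, Finset.prod_ne_zero_iff] at hv
  have hv0 : ∀ i, (fun j => v (i, j)) ≠ 0 := by
    intro i h0
    have h1 := hv.2 i (Finset.mem_univ i)
    rw [eval_X] at h1
    exact h1 (congrFun h0 0)
  obtain ⟨c, hc, hrep⟩ := exists_repCoord_mk hv0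
  refine ⟨fun i => Projectivization.mk k _ (hv0 i), ?_, ?_⟩
  · rw [hrep, eval_smul_ne_zero_iff hF hc v]
    exact hv.1.1
  · rw [hrep, eval_smul_ne_zero_iff hG hc v]
    exact hv.1.2

/-- An algebraic open condition on configurations which is satisfied at `v₀` is satisfied by
representatives of the cycles in some dense open set containing the cycle of `v₀`. -/
theorem exists_open_dense_cycles [Infinite k] {Q : (Fin n → PPoint k N) → Prop}
    {v₀ : Fin n → Fin (N + 1) → k} (hv₀ : ∀ i, v₀ i ≠ 0)
    {g : MvPolynomial (Fin n × Fin (N + 1)) k}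
    (hg : eval (fun ij : Fin n × Fin (N + 1) => v₀ ij.1 ij.2) g ≠ 0)
    (hQ : ∀ (w : Fin n → Fin (N + 1) → k) (hw : ∀ i, w i ≠ 0),
      eval (fun ij : Fin n × Fin (N + 1) => w ij.1 ij.2) g ≠ 0 →
        Q fun i => Projectivization.mk k (w i) (hw i)) :
    ∃ U : Set (Sym (PPoint k N) n),
      (@IsOpen _ (zariskiSym k N n) U ∧ @Dense _ (zariskiSym k N n) U) ∧
      cycleOf (fun i => Projectivization.mk k (v₀ i) (hv₀ i)) ∈ U ∧
      ∀ s ∈ U, ∃ x, cycleOf x = s ∧ Q x := by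
  obtain ⟨F, d, hF, hF₀, hFg⟩ := exists_isWeightedHomogeneous_of_eval_ne_zero hg
  refine ⟨cycleOf '' {x | eval (repCoord x) F ≠ 0}, ⟨?_, ?_⟩, ?_, ?_⟩
  · rw [isOpen_coinduced]
    -- The image of an open set is open because its saturation is the union of its translates under
    -- the symmetric group.
    have : cycleOf ⁻¹' (cycleOf '' {x : Fin n → PPoint k N | eval (repCoord x) F ≠ 0}) =
        ⋃ σ : Equiv.Perm (Fin n), {x | eval (repCoord (x ∘ σ)) F ≠ 0} := by
      ext x
      simp only [Set.mem_preimage, Set.mem_image, Set.mem_iUnion, Set.mem_ofPred_eq]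
      constructor
      · rintro ⟨y, hy, hyx⟩
        obtain ⟨σ, rfl⟩ := exists_perm_of_cycleOf_eq hyx
        exact ⟨σ, hy⟩
      · rintro ⟨σ, hσ⟩
        exact ⟨x ∘ σ, hσ, cycleOf_comp_perm x σ⟩
    rw [this]
    exact @isOpen_iUnion _ _ (zariskiProd k N n) _ fun σ => isOpen_eval_comp_perm_ne_zero hF σ
  · let := zariskiSym k N n
    rw [dense_iff_inter_open]
    rintro V hV ⟨s, hs⟩
    obtain ⟨x, rfl⟩ := cycleOf_surjective s
    obtain ⟨G, e, hG, hxG, hGV⟩ := exists_eval_ne_zero_subset (isOpen_coinduced.mp hV)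
      (show x ∈ cycleOf ⁻¹' V from hs)
    obtain ⟨y, hyF, hyG⟩ := exists_common_point hF hG
      (by rintro rfl; exact hF₀ (map_zero _)) (by rintro rfl; exact hxG (map_zero _))
    exact ⟨cycleOf y, hGV hyG, y, hyF, rfl⟩
  · obtain ⟨c, hc, hrep⟩ := exists_repCoord_mk hv₀
    refine ⟨_, ?_, rfl⟩
    rw [Set.mem_ofPred_eq, hrep, eval_smul_ne_zero_iff hF hc fun ij => v₀ ij.1 ij.2]
    exact hF₀
  · rintro _ ⟨x, hx, rfl⟩
    obtain ⟨c, hc, hcg⟩ := hFg _ hx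
    refine ⟨x, rfl, ?_⟩
    have hw : ∀ i, c i • (x i).rep ≠ 0 := fun i => smul_ne_zero (hc i) (x i).rep_nonzero
    have hx' : x = fun i => Projectivization.mk k (c i • (x i).rep) (hw i) := by
      funext i
      conv_lhs => rw [← (x i).mk_rep]
      rw [Projectivization.mk_eq_mk_iff' k _ _ (x i).rep_nonzero (hw i)]
      exact ⟨(c i)⁻¹, by rw [smul_smul, inv_mul_cancel₀ (hc i), one_smul]⟩
    rw [hx']
    exact hQ _ hw hcg

end Chow

end

/-! ### Conclusion for very general and for generic points -/

theorem corollary2p7 {k : Type*} [Field k] [IsAlgClosed k] [CharZero k]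
    (N β : ℕ) (hN : 1 ≤ N) (hβ : 1 ≤ β) :
    HoldsForVeryGeneralPoints k N ((β + N - 1).choose N)
        (fun X : Set (PPoint k N) => HarbourneHuneke X) ∧
      HarbourneHuneke (Set.range (genericProjPoint k N ((β + N - 1).choose N))) := by
  set n := (β + N - 1).choose N with hn
  set s := Finset.range (β + N - 1) with hs
  have hstar := isStar_moment k N s
  set P : Finset ℕ → Fin (N + 1) → k :=
    fun A j => (∏ a ∈ A, (Polynomial.X - Polynomial.C (a : k))).coeff j
  have hscard : s.card + 1 = β + N := by
    rw [hs, Finset.card_range]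
    omega
  let E : Fin n ≃ Finset.powersetCard N s :=
    (Finset.equivFinOfCardEq (by rw [Finset.card_powersetCard, hs, Finset.card_range])).symm
  set A : Fin n → Finset ℕ := fun i => (E i).1 with hAdef
  have hAs : ∀ i, A i ⊆ s := fun i => (Finset.mem_powersetCard.mp (E i).2).1
  have hAc : ∀ i, (A i).card = N := fun i => (Finset.mem_powersetCard.mp (E i).2).2
  have hA : Function.Injective A := Subtype.val_injective.comp E.injective
  have hsurj : ∀ B ⊆ s, B.card = N → ∃ i, A i = B := by
    intro B hB hBc
    obtain ⟨i, hi⟩ := E.surjective ⟨B, Finset.mem_powersetCard.mpr ⟨hB, hBc⟩⟩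
    exact ⟨i, congrArg Subtype.val hi⟩
  have hv₀ : ∀ i, P (A i) ≠ 0 := fun i => hstar.ne_zero _ (hAs i) (hAc i).le
  constructor
  · obtain ⟨g₀, hg₀, hinj⟩ := hstar.exists_injective hscard hβ hAs hAc hA
    obtain ⟨U₀, hU₀, hmem₀, hU₀inj⟩ :=
      exists_open_dense_cycles (Q := Function.Injective) hv₀ hg₀ hinj
    have hU : ∀ mt : ℕ × ℕ, ∃ U : Set (Sym (PPoint k N) n),
        (@IsOpen _ (zariskiSym k N n) U ∧ @Dense _ (zariskiSym k N n) U) ∧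
        cycleOf (fun i => Projectivization.mk k (P (A i)) (hv₀ i)) ∈ U ∧
        ∀ s ∈ U, ∃ x, cycleOf x = s ∧ FormContainment mt.1 mt.2 (Set.range x) := by
      intro mt
      obtain ⟨g, hg, hgL⟩ :=
        hstar.exists_formContainment hscard hN hβ hAs hAc hA hsurj mt.1 mt.2
      exact exists_open_dense_cycles hv₀ hg fun w hw hgw => hgL k w hw hgw
    choose U hUopen hUmem hUx using hU
    -- Index `0` makes the points distinct; index `i + 1` handles the pair `(m, t)` coded by `i`.
    refine ⟨fun i => i.casesOn U₀ fun i => U i.unpair, ?_, ⟨cycleOf fun i => Projectivization.mk k (P (A i)) (hv₀ i), Set.mem_iInter.mpr ?_⟩, ?_⟩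
    · rintro (_ | i)
      · exact hU₀
      · exact hUopen _
    · rintro (_ | i)
      · exact hmem₀
      · exact hUmem _
    · intro c hc
      rw [Set.mem_iInter] at hc
      obtain ⟨x, rfl, hx⟩ := hU₀inj c (hc 0)
      have hrange : ∀ y : Fin n → PPoint k N, cycleOf y = cycleOf x →
          Set.range y = {p | p ∈ cycleOf x} := by
        intro y hy
        rw [← hy]
        ext p
        change _ ↔ p ∈ Multiset.map y Finset.univ.val
        simp
      refine ⟨Multiset.Nodup.map hx Finset.univ.nodup, ?_⟩
      rw [← hrange x rfl]
      refine harbourneHuneke_of_formContainment (Set.finite_range x) fun m t _ => ?_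
      -- Each open set may provide a different ordering of the cycle, but the containment depends
      -- only on the underlying set.
      obtain ⟨y, hy, hyc⟩ := hUx (m, t) (cycleOf x) (by simpa using hc (Nat.pair m t + 1))
      rwa [hrange y hy, ← hrange x rfl] at hyc
  · refine harbourneHuneke_of_formContainment (Set.finite_range _) fun m t _ => ?_
    obtain ⟨g, hg, hgL⟩ := hstar.exists_formContainment hscard hN hβ hAs hAc hA hsurj m t
    refine hgL (GenericField k N n) (genericVec k N n) (genericVec_ne_zero k N n) ?_
    have h1 : (aeval (fun ij : Fin n × Fin (N + 1) => genericVec k N n ij.1 ij.2) g :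
        GenericField k N n) = algebraMap _ (GenericField k N n) g := by
      have h2 := DFunLike.congr_fun (comp_aeval (R := k)
        (X : Fin n × Fin (N + 1) → MvPolynomial (Fin n × Fin (N + 1)) k)
        (IsScalarTower.toAlgHom k (MvPolynomial (Fin n × Fin (N + 1)) k) (GenericField k N n))) g
      rw [AlgHom.comp_apply, aeval_X_left, AlgHom.id_apply] at h2
      exact h2.symm
    -- Evaluation at the generic coordinates is the inclusion into the fraction field, so it is
    -- enough that `g` is a nonzero polynomial, as its value at the star configuration shows.
    rw [h1, map_ne_zero_iff _ (IsFractionRing.injective _ _)]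
    rintro rfl
    exact hg (map_zero _)
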